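/- Consider $N$ agents $\dot x_i=f_i(x_i)+g_i(x_i)u_i$, $y_i=h_i(x_i)$, with $x_i\in\mathbb R^{n_i}$, $u_i,y_i\in\mathbb R$ and $f_i,g_i,h_i$ differentiable. Agent $i$ has (global) relative degree $r_i\ge 1$: $L_{g_i}L_{f_i}^kh_i\equiv 0$ for $k\le r_i-2$ and $L_{g_i}L_{f_i}^{r_i-1}h_i(x)\ne 0$ for all $x$. There is a $C^1$ diffeomorphism $\Phi_i=(\xi_i,\eta_i)$ of $\mathbb R^{n_i}$ onto $\mathbb R^{r_i}\times\mathbb R^{n_i-r_i}$ with $\xi_{i,k}=L_{f_i}^{k-1}h_i$ and $L_{g_i}\eta_i=0$, and the resulting internal dynamics $\dot\eta_i=\vartheta_i(\xi_i,\eta_i)$ is locally Lipschitz and input-to-state stable: $\|\eta_i(t)\|_2\le\gamma_{i,1}(\|\eta_i(0)\|_2,t)+\gamma_{i,2}(\sup_{0\le s\le t}\|\xi_i(s)\|_\infty)$ with $\gamma_{i,1}\in\mathcal{KL}$, $\gamma_{i,2}\in\mathcal K_\infty$. Put $\alpha_i=L_{f_i}^{r_i}h_i$, $\beta_i=L_{g_i}L_{f_i}^{r_i-1}h_i$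 and $r=\max_i r_i$. The weights $a_{ij}\ge 0$ ($a_{ij}>0$ iff agent $i$ receives information from agent $j$) define a time-invariant digraph that has a spanning tree (the information of some root reaches every agent along directed paths); $L$ is its Laplacian, $L=\mathrm{diag}(\sum_j a_{ij})-(a_{ij})$. Let $A\in\mathbb R^{r\times r}$ be the companion matrix of $s^r+b_rs^{r-1}+\dots+b_2s$ (ones on the superdiagonal, last row $(0,-b_2,\dots,-b_r)$) and $B=(0,\dots,0,1)^T$. Suppose that $0$ is a simple eigenvalue of $A$ and that all other eigenvalues of $A$ lie in the open left half plane. Let $\nu^TA=0$, with $\nu$ oriented so that $B^T\nu>0$, and let $q_1,\hat r,\mu>0$ and $Q_1=q_1\nu\nu^T$. Agent $i$ uses the local controller $u_i=(\hat u_i-\alpha_i)/\beta_i$. If $r_i<r$, the controller has the state $\phi_i\in\mathbb R^{r-r_i}$ with $\hat u_i=\phi_{i,1}$, $\dot\phi_{i,k}=\phi_{i,k+1}$ for $k<r-r_i$, and $\dot\phi_{i,r-r_i}=-\sum_{k=2}^{r_i}b_k\xi_{i,k}-\sum_{k=1}^{r-r_i}b_{r_i+k}\phi_{i,k}+v_i$;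 if $r_i=r$, it is static, with $\hat u_i=-\sum_{k=2}^{r}b_k\xi_{i,k}+v_i$. The cooperative input is, with $\hat\xi_i=(\xi_i,\phi_i)\in\mathbb R^r$, $$v_i=-\mu\sqrt{q_1\hat r}\,\nu^T\sum_j a_{ij}(\hat\xi_i-\hat\xi_j).$$ Then: (1) for every initial condition the closed loop has a solution on $[0,\infty)$, and every solution on $[0,\infty)$ reaches output consensus: $\lim_{t\to\infty}|y_i(t)-y_j(t)|=0$ for all $i,j$; (2) along solutions the stacked vector $\hat\xi=(\hat\xi_1,\dots,\hat\xi_N)$ satisfies $\dot{\hat\xi}=M\hat\xi$ with $M=I_N\otimes A-\mu\sqrt{q_1\hat r}\,L\otimes B\nu^T$, and the consensus speed, i.e. the smallest non-zero absolute value of the real parts of the eigenvalues of $M$, equals $$\min\{\mu\sqrt{q_1\hat r}\,B^T\nu\,\mathrm{Re}\,\lambda_{\min}(L),\ \mathrm{Re}\,\lambda_{\min}(-A)\},$$ where $\mathrm{Re}\,\lambda_{\min}$ denotes the smallest non-zero real part of an eigenvalue, and a minimum over the empty set is $+\infty$; (3) $P_1=\dfrac{\sqrt{q_1}}{\sqrt{\hat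 r}\,B^T\nu}\,\nu\nu^T$ is the unique positive semidefinite solution of the Riccati equation $P_1A+A^TP_1+Q_1-\hat rP_1BB^TP_1=0$, and $\hat rB^TP_1=\sqrt{q_1\hat r}\,\nu^T$, so that $v_i=-\mu\,\hat rB^TP_1\sum_j a_{ij}(\hat\xi_i-\hat\xi_j)$. -/

import Mathlib

open Set Filter Topology
open scoped Kronecker Matrix

namespace MAS

noncomputable section

/-! ### Graph -/

/-- Laplacian `L = D - 𝒜` of the weighted digraph with adjacency matrix `a`, where `a i j > 0` iff
agent `i` receives information from agent `j`, and `D` is the diagonal matrix of in-degrees. -/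
def laplacian {N : ℕ} (a : Matrix (Fin N) (Fin N) ℝ) : Matrix (Fin N) (Fin N) ℝ :=
  Matrix.diagonal (fun i => ∑ j, a i j) - a

/-- The digraph has a spanning tree: the information of some root node reaches every node along
directed paths (information travels from `p` to `q` when `a q p > 0`). -/
def HasSpanningTree {N : ℕ} (a : Matrix (Fin N) (Fin N) ℝ) : Prop :=
  ∃ root, ∀ i, Relation.ReflTransGen (fun p q => 0 < a q p) root i

/-! ### Agents, Lie derivatives, relative degree -/

/-- A SISO affine nonlinear agent `ẋ = f x + g x u`, `y = h x`, with state in `ℝⁿ`. -/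
structure Agent (n : ℕ) where
  /-- drift vector field -/
  f : EuclideanSpace ℝ (Fin n) → EuclideanSpace ℝ (Fin n)
  /-- input vector field -/
  g : EuclideanSpace ℝ (Fin n) → EuclideanSpace ℝ (Fin n)
  /-- output function -/
  h : EuclideanSpace ℝ (Fin n) → ℝ
  f_diff : Differentiable ℝ f
  g_diff : Differentiable ℝ g
  h_diff : Differentiable ℝ h

/-- Lie derivative `L_f h (x) = (∂h/∂x) f(x)`. -/
def lieD {n : ℕ} (f : EuclideanSpace ℝ (Fin n) → EuclideanSpace ℝ (Fin n))
    (h : EuclideanSpace ℝ (Fin n) → ℝ) : EuclideanSpace ℝ (Fin n) → ℝ :=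
  fun x => fderiv ℝ h x (f x)

/-- `L_f^k h`, the iterated Lie derivative of the output along the drift. -/
def Agent.lie {n : ℕ} (S : Agent n) (k : ℕ) : EuclideanSpace ℝ (Fin n) → ℝ :=
  (lieD S.f)^[k] S.h

/-- `S` has (global) relative degree `ρ > 0`. -/
def Agent.HasRelativeDegree {n : ℕ} (S : Agent n) (ρ : ℕ) : Prop :=
  0 < ρ ∧ (∀ k, k + 2 ≤ ρ → ∀ x, lieD S.g (S.lie k) x = 0) ∧
    ∀ x, lieD S.g (S.lie (ρ - 1)) x ≠ 0

/-- The linearized state `ξ = (h, L_f h, …, L_f^{ρ-1} h)`. -/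
def Agent.xi {n : ℕ} (S : Agent n) (ρ : ℕ) (x : EuclideanSpace ℝ (Fin n)) : Fin ρ → ℝ :=
  fun k => S.lie k x

/-- `α = L_f^ρ h`. -/
def Agent.alpha {n : ℕ} (S : Agent n) (ρ : ℕ) : EuclideanSpace ℝ (Fin n) → ℝ := S.lie ρ

/-- `β = L_g L_f^{ρ-1} h`. -/
def Agent.beta {n : ℕ} (S : Agent n) (ρ : ℕ) : EuclideanSpace ℝ (Fin n) → ℝ :=
  lieD S.g (S.lie (ρ - 1))

/-- `Φ x = (ξ, η)` is a global diffeomorphism that brings `S` to normal form: its first component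
is `ξ`, and `L_g η = 0`, so that the input does not enter the equation of `η`. -/
structure IsNormalForm {n : ℕ} (S : Agent n) (ρ : ℕ)
    (Φ : EuclideanSpace ℝ (Fin n) ≃ (Fin ρ → ℝ) × EuclideanSpace ℝ (Fin (n - ρ))) : Prop where
  contDiff : ContDiff ℝ 1 Φ
  contDiff_symm : ContDiff ℝ 1 Φ.symm
  fst_eq : ∀ x, (Φ x).1 = S.xi ρ x
  lie_snd : ∀ x, fderiv ℝ (fun y => (Φ y).2) x (S.g x) = 0

/-- The right-hand side `ϑ(ξ, η)` of the internal dynamics `η̇ = ϑ(ξ, η)`: it is `L_f η`, written in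
the coordinates `(ξ, η)`. -/
def internalField {n : ℕ} (S : Agent n) (ρ : ℕ)
    (Φ : EuclideanSpace ℝ (Fin n) ≃ (Fin ρ → ℝ) × EuclideanSpace ℝ (Fin (n - ρ)))
    (p : (Fin ρ → ℝ) × EuclideanSpace ℝ (Fin (n - ρ))) : EuclideanSpace ℝ (Fin (n - ρ)) :=
  fderiv ℝ (fun y => (Φ y).2) (Φ.symm p) (S.f (Φ.symm p))

/-! ### Input-to-state stability -/

/-- Class `𝒦_∞` on `[0, ∞)`. -/
structure IsKInf (γ : ℝ → ℝ) : Prop where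
  continuousOn : ContinuousOn γ (Ici 0)
  strictMonoOn : StrictMonoOn γ (Ici 0)
  unbounded : Tendsto γ atTop atTop
  map_zero : γ 0 = 0

/-- Class `𝒦ℒ` on `[0, ∞) × [0, ∞)`. -/
structure IsKL (γ : ℝ → ℝ → ℝ) : Prop where
  isKInf : ∀ t, 0 ≤ t → IsKInf (fun s => γ s t)
  antitoneOn : ∀ s, 0 ≤ s → AntitoneOn (γ s) (Ici 0)
  tendsto : ∀ s, 0 ≤ s → Tendsto (γ s) atTop (𝓝 0)

/-- `η̇ = ϑ(ξ, η)` is input-to-state stable with input `ξ`: along every solution on a time interval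
`[0, T]`, `‖η(T)‖ ≤ γ₁(‖η(0)‖, T) + γ₂(sup_{[0,T]} ‖ξ‖_∞)`. The supremum is expressed through an
arbitrary upper bound `M`. -/
def IsISS {ρ m : ℕ} (ϑ : (Fin ρ → ℝ) × EuclideanSpace ℝ (Fin m) → EuclideanSpace ℝ (Fin m)) :
    Prop :=
  ∃ γ₁ : ℝ → ℝ → ℝ, ∃ γ₂ : ℝ → ℝ, IsKL γ₁ ∧ IsKInf γ₂ ∧
    ∀ T : ℝ, 0 ≤ T → ∀ (ξ : ℝ → Fin ρ → ℝ) (η : ℝ → EuclideanSpace ℝ (Fin m)),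
      ContinuousOn ξ (Icc 0 T) →
      (∀ t ∈ Icc 0 T, HasDerivWithinAt η (ϑ (ξ t, η t)) (Icc 0 T) t) →
      ∀ M : ℝ, (∀ t ∈ Icc 0 T, ‖ξ t‖ ≤ M) → ‖η T‖ ≤ γ₁ ‖η 0‖ T + γ₂ M

/-! ### Local dynamic controllers

Coefficients are indexed as in the polynomial `s^r + b_r s^(r-1) + ⋯ + b_2 s`; only `b 2, …, b r`
are used. Indices of vectors start at `0`. -/

/-- The `r × r` companion matrix of `s^r + b_r s^(r-1) + ⋯ + b_2 s`. -/
def matA (r : ℕ) (b : ℕ → ℝ) : Matrix (Fin r) (Fin r) ℝ :=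
  fun i j => if (i : ℕ) + 1 = r then (if (j : ℕ) = 0 then 0 else - b (j + 1))
    else if (j : ℕ) = i + 1 then 1 else 0

/-- `B = (0, …, 0, 1)ᵀ ∈ ℝ^r`. -/
def vecB (r : ℕ) : Fin r → ℝ := fun i => if (i : ℕ) + 1 = r then 1 else 0

/-- `D_i ∈ ℝ^{(r-ρ) × ρ}`. -/
def matD (r ρ : ℕ) (b : ℕ → ℝ) : Matrix (Fin (r - ρ)) (Fin ρ) ℝ :=
  fun i j => if (i : ℕ) + 1 = r - ρ then (if (j : ℕ) = 0 then 0 else - b (j + 1)) else 0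

/-- `E_i ∈ ℝ^{(r-ρ) × (r-ρ)}`. -/
def matE (r ρ : ℕ) (b : ℕ → ℝ) : Matrix (Fin (r - ρ)) (Fin (r - ρ)) ℝ :=
  fun i j => if (i : ℕ) + 1 = r - ρ then - b (ρ + j + 1)
    else if (j : ℕ) = i + 1 then 1 else 0

/-- The augmented state `ξ̂ = (ξ, φ) ∈ ℝ^r`. -/
def xiHat {r ρ : ℕ} (ξ : Fin ρ → ℝ) (φ : Fin (r - ρ) → ℝ) : Fin r → ℝ :=
  fun k => if hk : (k : ℕ) < ρ then ξ ⟨k, hk⟩ else φ ⟨k - ρ, by omega⟩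

/-- The input `û` of the linearized chain: `φ₁` if the controller has states (`ρ < r`); if `ρ = r`
the controller is static and `û = -b_2 ξ_2 - ⋯ - b_r ξ_r + v`. -/
def uHat {r ρ : ℕ} (b : ℕ → ℝ) (ξ : Fin ρ → ℝ) (φ : Fin (r - ρ) → ℝ) (v : ℝ) : ℝ :=
  if h : 0 < r - ρ then φ ⟨0, h⟩
  else (∑ k : Fin ρ, if (k : ℕ) = 0 then 0 else - b (k + 1) * ξ k) + v

/-- The feedback-linearizing input `u = (û - α) / β`. -/
def controlU {n : ℕ} (S : Agent n) {r : ℕ} (ρ : ℕ) (b : ℕ → ℝ) (x : EuclideanSpace ℝ (Fin n))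
    (φ : Fin (r - ρ) → ℝ) (v : ℝ) : ℝ :=
  (uHat b (S.xi ρ x) φ v - S.alpha ρ x) / S.beta ρ x

/-- The rank-one cooperative input `v_i = -κ νᵀ ∑_j a_ij (ξ̂_i - ξ̂_j)`. -/
def coopInput {N r : ℕ} (a : Matrix (Fin N) (Fin N) ℝ) (κ : ℝ) (ν : Fin r → ℝ)
    (z : Fin N → Fin r → ℝ) (i : Fin N) : ℝ :=
  -κ * (ν ⬝ᵥ ∑ j, a i j • (z i - z j))

/-- `(x, φ)` is a trajectory on `[0, ∞)` of the multi-agent system with the local dynamic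
controllers and the cooperative inputs `v_i = -κ νᵀ ∑_j a_ij (ξ̂_i - ξ̂_j)`. -/
structure IsClosedLoopSolution {N r : ℕ} {n : Fin N → ℕ} (S : ∀ i, Agent (n i)) (ρ : Fin N → ℕ)
    (b : ℕ → ℝ) (a : Matrix (Fin N) (Fin N) ℝ) (κ : ℝ) (ν : Fin r → ℝ)
    (x : ∀ i, ℝ → EuclideanSpace ℝ (Fin (n i))) (φ : ∀ i, ℝ → Fin (r - ρ i) → ℝ) : Prop where
  agent : ∀ i, ∀ t, 0 ≤ t → HasDerivWithinAt (x i)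
    ((S i).f (x i t) +
      controlU (S i) (ρ i) b (x i t) (φ i t)
        (coopInput a κ ν (fun j => xiHat ((S j).xi (ρ j) (x j t)) (φ j t)) i) •
      (S i).g (x i t)) (Ici 0) t
  controller : ∀ i, ∀ t, 0 ≤ t → HasDerivWithinAt (φ i)
    (matD r (ρ i) b *ᵥ (S i).xi (ρ i) (x i t) + matE r (ρ i) b *ᵥ φ i t +
      coopInput a κ ν (fun j => xiHat ((S j).xi (ρ j) (x j t)) (φ j t)) i • vecB (r - ρ i))
    (Ici 0) t

/-- Output consensus along a trajectory: `|y_i(t) - y_j(t)| → 0` for all `i, j`. -/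
def OutputConsensus {N : ℕ} {n : Fin N → ℕ} (S : ∀ i, Agent (n i))
    (x : ∀ i, ℝ → EuclideanSpace ℝ (Fin (n i))) : Prop :=
  ∀ i j, Tendsto (fun t => |(S i).h (x i t) - (S j).h (x j t)|) atTop (𝓝 0)

/-! ### Eigenvalues and consensus speed -/

/-- The complex eigenvalues of a real square matrix. -/
def eigs {ι : Type*} [Fintype ι] [DecidableEq ι] (M : Matrix ι ι ℝ) : Set ℂ :=
  spectrum ℂ (M.map (algebraMap ℝ ℂ))

/-- `A` has exactly one eigenvalue at the origin (counted with algebraic multiplicity), and all its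
other eigenvalues lie in the open left half plane. -/
def SingleZeroOthersStable {ι : Type*} [Fintype ι] [DecidableEq ι] (A : Matrix ι ι ℝ) : Prop :=
  A.charpoly.rootMultiplicity 0 = 1 ∧ ∀ z ∈ eigs A, z ≠ 0 → z.re < 0

/-- `Re λ_min(M)`: the smallest non-zero real part of an eigenvalue of `M`
(`⊤` if there is no eigenvalue with non-zero real part). -/
def reLamMin {ι : Type*} [Fintype ι] [DecidableEq ι] (M : Matrix ι ι ℝ) : EReal :=
  ⨅ z ∈ {z ∈ eigs M | z.re ≠ 0}, (z.re : EReal)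

/-- Consensus speed of a linear closed loop with matrix `M`: the smallest non-zero absolute value of
the real part of an eigenvalue (`⊤` if there is none). -/
def consensusSpeed {ι : Type*} [Fintype ι] [DecidableEq ι] (M : Matrix ι ι ℝ) : EReal :=
  ⨅ z ∈ {z ∈ eigs M | z.re ≠ 0}, ((|z.re| : ℝ) : EReal)

/-- The matrix `I_N ⊗ A - κ L ⊗ B νᵀ` of the linearized closed loop, acting on the stacked vector
`(ξ̂_1, …, ξ̂_N)`. -/
def closedLoopMatrix {N : ℕ} (r : ℕ) (b : ℕ → ℝ) (a : Matrix (Fin N) (Fin N) ℝ) (κ : ℝ)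
    (ν : Fin r → ℝ) : Matrix (Fin N × Fin r) (Fin N × Fin r) ℝ :=
  (1 : Matrix (Fin N) (Fin N) ℝ) ⊗ₖ matA r b -
    laplacian a ⊗ₖ (κ • Matrix.vecMulVec (vecB r) ν)

/-- `P` solves the Riccati equation `P A + Aᵀ P + Q - r̂ P B Bᵀ P = 0`. -/
def IsRiccatiSolution {r : ℕ} (A : Matrix (Fin r) (Fin r) ℝ) (B : Fin r → ℝ)
    (Q : Matrix (Fin r) (Fin r) ℝ) (rhat : ℝ) (P : Matrix (Fin r) (Fin r) ℝ) : Prop :=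
  P * A + Aᵀ * P + Q - rhat • (P * Matrix.vecMulVec B B * P) = 0

end

end MAS

namespace MAS

/-! ### Convergence for linear systems with vanishing input -/

/-! Feedback linearization and the local controller turn every agent, whatever its relative degree,
into the same chain ξ̂_i' = A ξ̂_i + B v_i (`matA_mulVec_xiHat`), which the internal states never
enter. Consensus is therefore a linear question.

Since νᵀA = 0, the scalars w_i = νᵀξ̂_i obey w' = -κ(Bᵀν) L w with κ = μ√(q₁r̂). By Gershgorin the
non-zero eigenvalues of L lie in the open right half plane; by a maximum principle the spanning tree
makes ker L the constants and 0 semisimple. Hence L w → 0 (`tendsto_laplacian_flow`), so v_i → 0 and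
w_i - w_j → 0. The difference e = ξ̂_i - ξ̂_j satisfies e' = A e + B(v_i - v_j). If X·q is the
characteristic polynomial of A, then q(A) = yνᵀ, so q(A)e → 0; as q has only stable roots, e → 0
(`tendsto_zero_of_aeval`).

The same projection by ν splits the non-zero spectrum of M into -κ(Bᵀν)·spec L and spec A
(`mem_eigs_closedLoopMatrix`). On multiples of ννᵀ the Riccati equation is scalar; uniqueness
follows from a Sylvester equation with disjoint spectra (`riccati_unique`).

Global solutions come from a cascade: ξ̂ is solved by a matrix exponential, its ξ_i drives η_i,
whose escape is excluded by input-to-state stability, and Φ_i⁻¹ transports the result back. -/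

lemma norm_le_of_scalar_linear_ode {V : Type*} [NormedAddCommGroup V] [NormedSpace ℂ V]
    {l : ℂ} (hl : l.re < 0) {u d : ℝ → V} {T ε : ℝ} (hε : 0 ≤ ε)
    (hu : ∀ t, T ≤ t → HasDerivWithinAt u (l • u t + d t) (Ici T) t)
    (hd : ∀ t, T ≤ t → ‖d t‖ ≤ ε) {t : ℝ} (ht : T ≤ t) :
    ‖u t‖ ≤ Real.exp (l.re * (t - T)) * ‖u T‖ + ε / (-l.re) := by
  -- Integrating factor: (E u)' = E d, which avoids writing the variation-of-constants integral.
  set E : ℝ → ℂ := fun s => Complex.exp (-l * ((s - T : ℝ) : ℂ)) with hE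
  have hEd : ∀ s, HasDerivAt E (E s * (-l)) s := by
    intro s
    have h1 : HasDerivAt (fun s : ℝ => ((s - T : ℝ) : ℂ)) 1 s := by
      simpa using ((hasDerivAt_id s).sub_const T).ofReal_comp
    simpa [hE] using (h1.const_mul (-l)).cexp
  have hEn : ∀ s, ‖E s‖ = Real.exp (-l.re * (s - T)) := by
    intro s
    simp [hE, Complex.norm_exp, Complex.mul_re]
  have hm : ∀ s, T ≤ s → HasDerivWithinAt (fun s => E s • u s) (E s • d s) (Ici T) s := by
    intro s hs
    have := (hEd s).hasDerivWithinAt (s := Ici T) |>.smul (hu s hs)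
    refine this.congr_deriv ?_
    simp only [smul_add, smul_smul]
    module
  -- A primitive of ε‖E‖, not normalized to vanish at T; the surplus is harmless since it makes the
  -- bound at T larger than ‖u T‖.
  have hB : ∀ s, HasDerivAt
      (fun s => ‖u T‖ + ε * (Real.exp (-l.re * (s - T)) / (-l.re)))
      (ε * Real.exp (-l.re * (s - T))) s := by
    intro s
    have h1 : HasDerivAt (fun s : ℝ => -l.re * (s - T)) (-l.re) s := by
      simpa using ((hasDerivAt_id s).sub_const T).const_mul (-l.re)
    have h2 := ((h1.exp.div_const (-l.re)).const_mul ε).const_add ‖u T‖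
    refine h2.congr_deriv ?_
    field_simp [hl.ne]
  have key := image_norm_le_of_norm_deriv_right_le_deriv_boundary
    (f := fun s => E s • u s) (f' := fun s => E s • d s) (a := T) (b := t)
    (fun s hs => ((hm s hs.1).mono Icc_subset_Ici_self).continuousWithinAt)
    (fun s hs => (hm s hs.1).mono (Ici_subset_Ici.2 hs.1))
    (B := fun s => ‖u T‖ + ε * (Real.exp (-l.re * (s - T)) / (-l.re)))
    (by
      have : 0 ≤ ε * (1 / (-l.re)) := by
        have : 0 < -l.re := by linarith
        positivity
      simpa [hE] using this) hB
    (fun s hs => by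
      rw [norm_smul, hEn, mul_comm]
      exact mul_le_mul_of_nonneg_right (hd s hs.1) (Real.exp_nonneg _)) ⟨ht, le_rfl⟩
  simp only [norm_smul, hEn] at key
  have h3 : Real.exp (l.re * (t - T)) * Real.exp (-l.re * (t - T)) = 1 := by
    rw [← Real.exp_add]; simp
  have h4 := mul_le_mul_of_nonneg_left key (Real.exp_nonneg (l.re * (t - T)))
  calc ‖u t‖ = Real.exp (l.re * (t - T)) * (Real.exp (-l.re * (t - T)) * ‖u t‖) := by
        rw [← mul_assoc, h3, one_mul]
    _ ≤ _ := h4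
    _ = Real.exp (l.re * (t - T)) * ‖u T‖ +
        ε * ((Real.exp (l.re * (t - T)) * Real.exp (-l.re * (t - T))) / (-l.re)) := by ring
    _ = _ := by rw [h3]; ring

lemma tendsto_zero_of_scalar_linear_ode {V : Type*} [NormedAddCommGroup V] [NormedSpace ℂ V]
    {l : ℂ} (hl : l.re < 0) {u d : ℝ → V}
    (hu : ∀ t, 0 ≤ t → HasDerivWithinAt u (l • u t + d t) (Ici 0) t)
    (hd : Tendsto d atTop (𝓝 0)) : Tendsto u atTop (𝓝 0) := by
  rw [Metric.tendsto_atTop]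
  intro δ hδ
  have hσ : 0 < -l.re := by linarith
  -- The tolerance makes the forced part ε / (-Re l) equal to δ/2; the transient supplies the other
  -- half.
  obtain ⟨T, hT⟩ := (Metric.tendsto_atTop.1 hd) (δ / 2 * (-l.re)) (by positivity)
  set T' := max T 0
  have hexp : Tendsto (fun t : ℝ => Real.exp (l.re * (t - T')) * ‖u T'‖) atTop (𝓝 0) := by
    have h1 : Tendsto (fun t : ℝ => l.re * (t - T')) atTop atBot :=
      (tendsto_atTop_add_const_right atTop (-T') tendsto_id).const_mul_atTop_of_neg hl
    simpa using (Real.tendsto_exp_atBot.comp h1).mul_const ‖u T'‖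
  obtain ⟨T₂, hT₂⟩ := (Metric.tendsto_atTop.1 hexp) (δ / 2) (by positivity)
  refine ⟨max T' T₂, fun t ht => ?_⟩
  have ht1 : T' ≤ t := (le_max_left _ _).trans ht
  have h := norm_le_of_scalar_linear_ode hl (u := u) (d := d) (T := T')
    (ε := δ / 2 * (-l.re)) (by positivity)
    (fun s hs => (hu s ((le_max_right _ _).trans hs)).mono
      (Ici_subset_Ici.2 (le_max_right _ _)))
    (fun s hs => by simpa using (hT s ((le_max_left _ _).trans hs)).le) ht1
  have h2 := hT₂ t ((le_max_right _ _).trans ht)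
  rw [Real.dist_eq, sub_zero] at h2
  have h3 := (abs_lt.1 h2).2
  rw [mul_div_cancel_right₀ _ hσ.ne'] at h
  rw [dist_zero_right]
  linarith

lemma hasDerivWithinAt_mulVec {ι κ 𝕜 : Type*} [Fintype ι] [Fintype κ] [RCLike 𝕜]
    (T : Matrix κ ι 𝕜)
    {e : ℝ → ι → 𝕜} {e' : ι → 𝕜} {s : Set ℝ} {t : ℝ} (h : HasDerivWithinAt e e' s t) :
    HasDerivWithinAt (fun t => T *ᵥ e t) (T *ᵥ e') s t := by
  classical
  rw [hasDerivWithinAt_pi] at h ⊢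
  intro i
  simp only [Matrix.mulVec, dotProduct]
  exact HasDerivWithinAt.fun_sum fun j _ => (h j).const_mul _

lemma tendsto_mulVec_zero {α ι κ 𝕜 : Type*} [Fintype ι] [Fintype κ] [RCLike 𝕜]
    (T : Matrix κ ι 𝕜) {l : Filter α} {e : α → ι → 𝕜} (h : Tendsto e l (𝓝 0)) :
    Tendsto (fun t => T *ᵥ e t) l (𝓝 0) := by
  have hc : Continuous fun v : ι → 𝕜 => T *ᵥ v := by fun_prop
  simpa [Function.comp_def] using (hc.tendsto 0).comp h

/-- If all roots of `p` have negative real part, then a solution `e` of `ė = T e + d` with `d → 0`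
and `p(T) e → 0` tends to `0`. -/
lemma tendsto_zero_of_aeval {ι : Type*} [Fintype ι] [DecidableEq ι] (T : Matrix ι ι ℂ)
    (m : ℕ) (p : Polynomial ℂ) (hp : p ≠ 0) (hm : p.natDegree = m)
    (hroots : ∀ z, p.IsRoot z → z.re < 0) {e d : ℝ → ι → ℂ}
    (he : ∀ t, 0 ≤ t → HasDerivWithinAt e (T *ᵥ e t + d t) (Ici 0) t)
    (hd : Tendsto d atTop (𝓝 0))
    (hlim : Tendsto (fun t => (Polynomial.aeval T p) *ᵥ e t) atTop (𝓝 0)) :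
    Tendsto e atTop (𝓝 0) := by
  induction m generalizing p e d with
  | zero =>
    obtain ⟨c, rfl⟩ := Polynomial.natDegree_eq_zero.1 hm
    have hc : c ≠ 0 := fun h => hp (by simp [h])
    have h1 : Tendsto (fun t => c⁻¹ • (c • e t)) atTop (𝓝 (c⁻¹ • 0)) := by
      refine Tendsto.const_smul ?_ _
      simpa [Polynomial.aeval_C, Algebra.algebraMap_eq_smul_one, Matrix.smul_mulVec] using hlim
    simpa [smul_smul, hc] using h1
  | succ m ih =>
    -- With p = (X - l) q, the vector (T - l)e solves the same equation with input (T - l)d, and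
    -- q(T) sends it to p(T)e. Induction makes it vanish in the limit; then e' = l e + ((T - l)e +
    -- d) is a scalar equation with vanishing input.
    obtain ⟨l, hl⟩ := IsAlgClosed.exists_root p
      (by rw [Polynomial.degree_eq_natDegree hp, hm]; exact_mod_cast Nat.succ_ne_zero m)
    obtain ⟨q, rfl⟩ := Polynomial.dvd_iff_isRoot.2 hl
    have hq : q ≠ 0 := right_ne_zero_of_mul hp
    have hqm : q.natDegree = m := by
      rw [Polynomial.natDegree_mul (Polynomial.X_sub_C_ne_zero l) hq,
        Polynomial.natDegree_X_sub_C] at hm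
      omega
    have hS : Polynomial.aeval T (Polynomial.X - Polynomial.C l) = T - l • (1 : Matrix ι ι ℂ) := by
      simp [Algebra.algebraMap_eq_smul_one]
    have hcomm : (T - l • (1 : Matrix ι ι ℂ)) * T = T * (T - l • (1 : Matrix ι ι ℂ)) := by
      simp [sub_mul, mul_sub]
    have h2 : Tendsto (fun t => (T - l • (1 : Matrix ι ι ℂ)) *ᵥ e t) atTop (𝓝 0) := by
      refine ih q hq hqm (fun z hz => hroots z (by simp [Polynomial.IsRoot.def.1 hz]))
        (d := fun t => (T - l • (1 : Matrix ι ι ℂ)) *ᵥ d t) (fun t ht => ?_)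
        (tendsto_mulVec_zero _ hd) ?_
      · refine (hasDerivWithinAt_mulVec _ (he t ht)).congr_deriv ?_
        rw [Matrix.mulVec_add, Matrix.mulVec_mulVec, Matrix.mulVec_mulVec, hcomm]
      · refine hlim.congr fun t => ?_
        rw [mul_comm, map_mul, hS, Matrix.mulVec_mulVec]
    refine tendsto_zero_of_scalar_linear_ode (hroots l hl)
      (d := fun t => (T - l • (1 : Matrix ι ι ℂ)) *ᵥ e t + d t) (fun t ht => ?_)
      (by simpa using h2.add hd)
    refine (he t ht).congr_deriv ?_
    simp only [Matrix.sub_mulVec, Matrix.smul_mulVec, Matrix.one_mulVec]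
    abel

/-! ### Complexification of real matrices -/

/-- The complexification of a real matrix. -/
noncomputable abbrev toC {ι κ : Type*} (M : Matrix ι κ ℝ) : Matrix ι κ ℂ :=
  M.map (algebraMap ℝ ℂ)

lemma re_toC_mulVec {ι κ : Type*} [Fintype ι] (M : Matrix κ ι ℝ) (v : ι → ℂ) :
    (fun i => ((toC M *ᵥ v) i).re) = M *ᵥ fun i => (v i).re := by
  ext i; simp [Matrix.mulVec, dotProduct]

lemma im_toC_mulVec {ι κ : Type*} [Fintype ι] (M : Matrix κ ι ℝ) (v : ι → ℂ) :
    (fun i => ((toC M *ᵥ v) i).im) = M *ᵥ fun i => (v i).im := by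
  ext i; simp [Matrix.mulVec, dotProduct]

lemma toC_mulVec_ofReal {ι κ : Type*} [Fintype ι] (M : Matrix κ ι ℝ) (v : ι → ℝ) :
    toC M *ᵥ (fun i => (v i : ℂ)) = fun i => ((M *ᵥ v) i : ℂ) := by
  ext i; simp [Matrix.mulVec, dotProduct]

lemma toC_mulVec_eq_zero {ι κ : Type*} [Fintype ι] (M : Matrix κ ι ℝ) (v : ι → ℂ) :
    toC M *ᵥ v = 0 ↔ (M *ᵥ fun i => (v i).re) = 0 ∧ (M *ᵥ fun i => (v i).im) = 0 := by
  rw [← re_toC_mulVec, ← im_toC_mulVec]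
  constructor
  · intro h
    simp [h, funext_iff]
  · rintro ⟨h1, h2⟩
    ext i
    exact Complex.ext (congrFun h1 i) (congrFun h2 i)

lemma mem_eigs_iff {ι : Type*} [Fintype ι] [DecidableEq ι] {M : Matrix ι ι ℝ} {z : ℂ} :
    z ∈ eigs M ↔ ∃ v ≠ 0, toC M *ᵥ v = z • v := by
  rw [eigs, ← Matrix.spectrum_toLin', ← Module.End.hasEigenvalue_iff_mem_spectrum]
  constructor
  · intro h
    obtain ⟨v, hv⟩ := h.exists_hasEigenvector
    exact ⟨v, hv.2, by simpa only [Matrix.toLin'_apply] using hv.apply_eq_smul⟩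
  · rintro ⟨v, hv, h⟩
    exact Module.End.hasEigenvalue_of_hasEigenvector (x := v)
      ⟨Module.End.mem_eigenspace_iff.2 (by rw [Matrix.toLin'_apply]; exact h), hv⟩

/-! ### The Laplacian -/

section Laplacian

variable {N : ℕ} {a : Matrix (Fin N) (Fin N) ℝ}

lemma laplacian_mulVec (a : Matrix (Fin N) (Fin N) ℝ) (u : Fin N → ℝ) (i : Fin N) :
    (laplacian a *ᵥ u) i = ∑ j, a i j * (u i - u j) := by
  rw [laplacian, Matrix.sub_mulVec, Pi.sub_apply, Matrix.mulVec_diagonal]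
  simp [Matrix.mulVec, dotProduct, mul_sub, Finset.sum_mul]

/-- Maximum principle. At a maximizer q every term a_qj (u_q - u_j) is nonnegative, so a nonpositive
sum forces the in-neighbours of q to be maximizers too; following edges backwards reaches the root.
-/
lemma le_of_laplacian_mulVec_nonpos (ha : ∀ i j, 0 ≤ a i j) {u : Fin N → ℝ}
    (hu : ∀ i, (∀ j, u j ≤ u i) → (laplacian a *ᵥ u) i ≤ 0) {root : Fin N}
    (hroot : ∀ i, Relation.ReflTransGen (fun p q => 0 < a q p) root i) (i : Fin N) :
    u i ≤ u root := by
  have : Nonempty (Fin N) := ⟨root⟩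
  obtain ⟨m, hm⟩ := Finite.exists_max u
  have key : ∀ p, Relation.ReflTransGen (fun p q => 0 < a q p) p m → u m ≤ u p := by
    intro p hp
    induction hp using Relation.ReflTransGen.head_induction_on with
    | refl => exact le_rfl
    | head hpq _ ih =>
      rename_i p q _
      have hmax : ∀ j, u j ≤ u q := fun j => (hm j).trans ih
      have h := hu q hmax
      rw [laplacian_mulVec] at h
      have h0 : ∀ j ∈ Finset.univ, 0 ≤ a q j * (u q - u j) :=
        fun j _ => mul_nonneg (ha q j) (sub_nonneg.2 (hmax j))
      have h1 := (Finset.sum_eq_zero_iff_of_nonneg h0).1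
        (le_antisymm h (Finset.sum_nonneg h0)) p (Finset.mem_univ _)
      rcases mul_eq_zero.1 h1 with h2 | h2
      · exact absurd h2 hpq.ne'
      · linarith
  exact (hm i).trans (key root (hroot m))

lemma eq_of_laplacian_mulVec_eq_zero (ha : ∀ i j, 0 ≤ a i j) (hG : HasSpanningTree a)
    {u : Fin N → ℝ} (hu : laplacian a *ᵥ u = 0) (i j : Fin N) : u i = u j := by
  obtain ⟨root, hroot⟩ := hG
  have h1 : ∀ i, u i ≤ u root :=
    le_of_laplacian_mulVec_nonpos ha (fun i _ => by simp [hu]) hroot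
  have h2 : ∀ i, (-u) i ≤ (-u) root :=
    le_of_laplacian_mulVec_nonpos ha (fun i _ => by simp [hu, Matrix.mulVec_neg]) hroot
  have h3 : ∀ i, u i = u root := fun i => le_antisymm (h1 i) (by simpa using h2 i)
  rw [h3 i, h3 j]

/-- The eigenvalue 0 is semisimple: L u is constant, yet nonnegative where u is maximal and
nonpositive where u is minimal. -/
lemma laplacian_mulVec_eq_zero_of_sq (ha : ∀ i j, 0 ≤ a i j) (hG : HasSpanningTree a)
    {u : Fin N → ℝ} (hu : laplacian a *ᵥ (laplacian a *ᵥ u) = 0) : laplacian a *ᵥ u = 0 := by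
  have hconst := eq_of_laplacian_mulVec_eq_zero ha hG hu
  obtain ⟨root, -⟩ := hG
  have : Nonempty (Fin N) := ⟨root⟩
  obtain ⟨m, hm⟩ := Finite.exists_max u
  obtain ⟨m', hm'⟩ := Finite.exists_min u
  have h1 : 0 ≤ (laplacian a *ᵥ u) m := by
    rw [laplacian_mulVec]
    exact Finset.sum_nonneg fun j _ => mul_nonneg (ha m j) (sub_nonneg.2 (hm j))
  have h2 : (laplacian a *ᵥ u) m' ≤ 0 := by
    rw [laplacian_mulVec]
    exact Finset.sum_nonpos fun j _ =>
      mul_nonpos_of_nonneg_of_nonpos (ha m' j) (sub_nonpos.2 (hm' j))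
  ext i
  exact le_antisymm ((hconst i m').trans_le h2) (h1.trans_eq (hconst m i))

/-- Gershgorin: each disc has centre D ≥ 0 and radius D, so it meets the closed left half plane only
at 0. Self-loops cancel on the diagonal, hence D omits a_kk. -/
lemma re_pos_of_mem_eigs_laplacian (ha : ∀ i j, 0 ≤ a i j) {z : ℂ}
    (hz : z ∈ eigs (laplacian a)) (hz0 : z ≠ 0) : 0 < z.re := by
  rw [eigs, ← Matrix.spectrum_toLin', ← Module.End.hasEigenvalue_iff_mem_spectrum] at hz
  obtain ⟨k, hk⟩ := eigenvalue_mem_ball hz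
  set D : ℝ := ∑ j ∈ Finset.univ.erase k, a k j with hD
  have hD0 : 0 ≤ D := Finset.sum_nonneg fun j _ => ha k j
  have hdiag : laplacian a k k = D := by
    rw [laplacian, Matrix.sub_apply, Matrix.diagonal_apply_eq, hD,
      ← Finset.sum_erase_add _ _ (Finset.mem_univ k), add_sub_cancel_right]
  have hrad : ∑ j ∈ Finset.univ.erase k, ‖(laplacian a).map (algebraMap ℝ ℂ) k j‖ = D := by
    refine Finset.sum_congr rfl fun j hj => ?_
    have : k ≠ j := (Finset.ne_of_mem_erase hj).symm
    simp [laplacian, Matrix.diagonal_apply_ne _ this, abs_of_nonneg (ha k j)]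
  rw [hrad, Metric.mem_closedBall, Matrix.map_apply, hdiag, dist_eq_norm] at hk
  have h2 : ‖z - (D : ℂ)‖ ^ 2 ≤ D ^ 2 := pow_le_pow_left₀ (norm_nonneg _) hk 2
  rw [← Complex.normSq_eq_norm_sq, Complex.normSq_apply] at h2
  simp only [Complex.sub_re, Complex.ofReal_re, Complex.sub_im, Complex.ofReal_im, sub_zero] at h2
  by_contra hneg
  rw [not_lt] at hneg
  have hre : z.re = 0 := by nlinarith [mul_nonneg hD0 (neg_nonneg.2 hneg)]
  have him : z.im = 0 := by rw [hre] at h2; nlinarith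
  exact hz0 (Complex.ext hre him)

/-- Solutions of the consensus flow `ẇ = -c L w` satisfy `L w → 0`. -/
lemma tendsto_laplacian_flow (ha : ∀ i j, 0 ≤ a i j) (hG : HasSpanningTree a) {c : ℝ} (hc : 0 < c)
    {w : ℝ → Fin N → ℝ}
    (hw : ∀ t, 0 ≤ t → HasDerivWithinAt w (-c • (laplacian a *ᵥ w t)) (Ici 0) t) :
    Tendsto (fun t => laplacian a *ᵥ w t) atTop (𝓝 0) := by
  set G : Matrix (Fin N) (Fin N) ℝ := -c • laplacian a with hGdef
  have hGu : ∀ u, G *ᵥ u = -c • (laplacian a *ᵥ u) := fun u => by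
    rw [hGdef, Matrix.smul_mulVec]
  have hker : ∀ u, G *ᵥ (G *ᵥ u) = 0 → G *ᵥ u = 0 := by
    intro u hu
    rw [hGu, hGu, Matrix.mulVec_smul, smul_smul] at hu
    rw [hGu, laplacian_mulVec_eq_zero_of_sq ha hG, smul_zero]
    exact (smul_eq_zero.1 hu).resolve_left (by nlinarith [mul_pos hc hc])
  have hkerC : ∀ u, toC G *ᵥ (toC G *ᵥ u) = 0 → toC G *ᵥ u = 0 := by
    intro u hu
    rw [toC_mulVec_eq_zero, re_toC_mulVec, im_toC_mulVec] at hu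
    exact (toC_mulVec_eq_zero _ _).2 ⟨hker _ hu.1, hker _ hu.2⟩
  have hpow : ∀ m : ℕ, ∀ u, (toC G) ^ m *ᵥ u = 0 → toC G *ᵥ u = 0 := by
    intro m
    induction m with
    | zero => intro u hu; simp at hu; simp [hu]
    | succ m ih =>
      intro u hu
      rw [pow_succ, ← Matrix.mulVec_mulVec] at hu
      exact hkerC u (ih _ hu)
  have hp0 : (toC G).charpoly ≠ 0 := (Matrix.charpoly_monic _).ne_zero
  obtain ⟨q, hq, hq0⟩ := Polynomial.exists_eq_pow_rootMultiplicity_mul_and_not_dvd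
    (toC G).charpoly hp0 0
  rw [Polynomial.C_0, sub_zero] at hq hq0
  set m := Polynomial.rootMultiplicity 0 (toC G).charpoly
  -- Cayley–Hamilton gives G^m q(G) = 0, and semisimplicity lowers the power to one. So q(G)
  -- annihilates G w exactly, and the roots of q are stable.
  have hqG : ∀ u, toC G *ᵥ (Polynomial.aeval (toC G) q *ᵥ u) = 0 := by
    intro u
    apply hpow m
    have := Matrix.aeval_self_charpoly (toC G)
    rw [hq, map_mul, map_pow, Polynomial.aeval_X] at this
    rw [Matrix.mulVec_mulVec, this, Matrix.zero_mulVec]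
  have hcommq : toC G * Polynomial.aeval (toC G) q = Polynomial.aeval (toC G) q * toC G := by
    have h1 : Polynomial.aeval (toC G) (Polynomial.X * q) =
        Polynomial.aeval (toC G) (q * Polynomial.X) := by rw [mul_comm]
    simpa only [map_mul, Polynomial.aeval_X] using h1
  have hroots : ∀ z, q.IsRoot z → z.re < 0 := by
    intro z hz
    have hz0 : z ≠ 0 := by
      rintro rfl
      exact hq0 (by simpa using Polynomial.dvd_iff_isRoot.2 hz)
    have hzG : z ∈ eigs G := by
      rw [eigs, Matrix.mem_spectrum_iff_isRoot_charpoly, hq]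
      simp [Polynomial.IsRoot.def.1 hz]
    obtain ⟨v, hv, hvz⟩ := mem_eigs_iff.1 hzG
    have hL : -z / c ∈ eigs (laplacian a) := by
      refine mem_eigs_iff.2 ⟨v, hv, ?_⟩
      have h1 : toC G = (-c : ℂ) • toC (laplacian a) := by
        ext i j; simp [hGdef]
      rw [h1, Matrix.smul_mulVec] at hvz
      have hcc : (c : ℂ) ≠ 0 := by exact_mod_cast hc.ne'
      rw [div_eq_inv_mul, mul_neg, neg_smul, mul_smul, ← hvz, smul_smul, ← neg_smul]
      simp [hcc]
    have := re_pos_of_mem_eigs_laplacian ha hL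
      (div_ne_zero (neg_ne_zero.2 hz0) (by exact_mod_cast hc.ne'))
    rw [Complex.div_ofReal_re, Complex.neg_re] at this
    have := (div_pos_iff_of_pos_right hc).1 this
    linarith
  have hE : Tendsto (fun t => toC G *ᵥ fun i => (w t i : ℂ)) atTop (𝓝 0) := by
    refine tendsto_zero_of_aeval (toC G) _ q (by rintro rfl; simp at hq0) rfl hroots
      (d := fun _ => 0) (fun t ht => ?_) tendsto_const_nhds ?_
    · rw [add_zero]
      refine hasDerivWithinAt_mulVec (toC G) ?_
      rw [toC_mulVec_ofReal, hGu]
      have h1 := hasDerivWithinAt_pi.1 (hw t ht)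
      exact hasDerivWithinAt_pi.2 fun i => (h1 i).ofReal_comp
    · simp only [Matrix.mulVec_mulVec, ← hcommq]
      simp only [← Matrix.mulVec_mulVec, hqG]
      exact tendsto_const_nhds
  rw [tendsto_pi_nhds] at hE ⊢
  intro i
  have h1 := ((Complex.continuous_re.tendsto _).comp (hE i)).const_mul (-c⁻¹)
  simp only [Pi.zero_apply, Complex.zero_re, mul_zero] at h1
  refine h1.congr fun t => ?_
  simp only [Function.comp, toC_mulVec_ofReal, Complex.ofReal_re, hGu]
  simp [hc.ne']

/-- As ker L consists of constants, the functional u ↦ u_i - u_j vanishes on it and is a linear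
combination of the rows of L. Convergence of w itself is not needed. -/
lemma tendsto_sub_of_tendsto_laplacian_mulVec (ha : ∀ i j, 0 ≤ a i j) (hG : HasSpanningTree a)
    {w : ℝ → Fin N → ℝ} (hw : Tendsto (fun t => laplacian a *ᵥ w t) atTop (𝓝 0)) (i j : Fin N) :
    Tendsto (fun t => w t i - w t j) atTop (𝓝 0) := by
  set π : Fin N → (Fin N → ℝ) →ₗ[ℝ] ℝ := fun k => LinearMap.proj k with hπ
  set D : (Fin N → ℝ) →ₗ[ℝ] ℝ := π i - π j with hD
  have hle : ⨅ k, LinearMap.ker (π k ∘ₗ (laplacian a).mulVecLin) ≤ LinearMap.ker D := by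
    intro u hu
    have hu' : laplacian a *ᵥ u = 0 := by
      ext k
      simpa [hπ] using (Submodule.mem_iInf _).1 hu k
    simp [hD, hπ, eq_of_laplacian_mulVec_eq_zero ha hG hu' i j]
  obtain ⟨f, hf⟩ := (Submodule.mem_span_range_iff_exists_fun ℝ).1 (mem_span_of_iInf_ker_le_ker hle)
  have h1 : Tendsto (fun t => ∑ k, f k * (laplacian a *ᵥ w t) k) atTop (𝓝 (∑ k, f k * 0)) :=
    tendsto_finsetSum _ fun k _ => ((tendsto_pi_nhds.1 hw) k).const_mul _
  simp only [mul_zero, Finset.sum_const_zero] at h1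
  refine h1.congr fun t => ?_
  have := LinearMap.congr_fun hf (w t)
  simpa [hD, hπ] using this

end Laplacian

/-! ### The companion matrix -/

section Companion

variable {r : ℕ} {b : ℕ → ℝ} {ν : Fin r → ℝ}

/-- Column k+1 of xA = 0 expresses x_k through the last entry of x, so that entry, Bᵀx, determines
the left kernel. -/
lemma eq_zero_of_vecMul_matA {x : Fin r → ℝ} (hx : Matrix.vecMul x (matA r b) = 0)
    (hlast : vecB r ⬝ᵥ x = 0) : x = 0 := by
  have hl : ∀ i : Fin r, (i : ℕ) + 1 = r → x i = 0 := by
    intro i hi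
    rw [dotProduct, Finset.sum_eq_single i] at hlast
    · simpa [vecB, hi] using hlast
    · intro k _ hk
      have : (k : ℕ) + 1 ≠ r := fun h => hk (Fin.ext (by omega))
      simp [vecB, this]
    · simp
  ext k
  by_cases hk : (k : ℕ) + 1 = r
  · exact hl k hk
  · have hlt : (k : ℕ) + 1 < r := by omega
    have h := congrFun hx ⟨k + 1, hlt⟩
    rw [Matrix.vecMul, dotProduct, Finset.sum_eq_single k] at h
    · simpa [matA, hk] using h
    · intro i _ hi
      by_cases hi' : (i : ℕ) + 1 = r
      · simp [hl i hi']
      · have : (k : ℕ) ≠ i := fun h => hi (Fin.ext h.symm)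
        simp [matA, hi', this]
    · simp

lemma eq_smul_of_vecMul_matA (hν : Matrix.vecMul ν (matA r b) = 0) (hBν : 0 < vecB r ⬝ᵥ ν)
    {x : Fin r → ℝ} (hx : Matrix.vecMul x (matA r b) = 0) :
    x = ((vecB r ⬝ᵥ x) / (vecB r ⬝ᵥ ν)) • ν := by
  refine sub_eq_zero.1 (eq_zero_of_vecMul_matA (b := b) ?_ ?_)
  · rw [Matrix.sub_vecMul, Matrix.smul_vecMul, hx, hν]; simp
  · rw [dotProduct_sub, dotProduct_smul, smul_eq_mul, div_mul_cancel₀ _ hBν.ne', sub_self]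

/-- The cofactor `q` of `X` in the characteristic polynomial of `A` has only stable roots, and
`q(A)` is a rank-one matrix `y νᵀ`. -/
lemma exists_stable_cofactor (hA : SingleZeroOthersStable (matA r b))
    (hν : Matrix.vecMul ν (matA r b) = 0) (hBν : 0 < vecB r ⬝ᵥ ν) :
    ∃ (q : Polynomial ℂ) (y : Fin r → ℝ), (∀ z, q.IsRoot z → z.re < 0) ∧ q ≠ 0 ∧
      Polynomial.aeval (toC (matA r b)) q = toC (Matrix.vecMulVec y ν) := by
  set A := matA r b
  obtain ⟨p, hp, hp0⟩ := Polynomial.exists_eq_pow_rootMultiplicity_mul_and_not_dvd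
    A.charpoly (Matrix.charpoly_monic _).ne_zero 0
  rw [hA.1, pow_one, Polynomial.C_0, sub_zero] at hp
  rw [Polynomial.C_0, sub_zero] at hp0
  -- Every row of p(A) is thus a left null vector of A, hence a multiple of ν; this is the rank-one
  -- form.
  have hpA : Polynomial.aeval A p * A = 0 := by
    have := Matrix.aeval_self_charpoly A
    rw [hp, mul_comm, map_mul, Polynomial.aeval_X] at this
    exact this
  have hne : p.map (algebraMap ℝ ℂ) ≠ 0 := by
    rw [Polynomial.map_ne_zero_iff (algebraMap ℝ ℂ).injective]
    rintro rfl
    simp at hp0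
  refine ⟨p.map (algebraMap ℝ ℂ),
    fun i => (vecB r ⬝ᵥ Polynomial.aeval A p i) / (vecB r ⬝ᵥ ν), ?_, hne, ?_⟩
  · intro z hz
    refine hA.2 z ?_ ?_
    · rw [eigs, Matrix.mem_spectrum_iff_isRoot_charpoly, Matrix.charpoly_map, hp]
      simp [Polynomial.IsRoot.def.1 hz]
    · rintro rfl
      apply hp0
      have h0 : (algebraMap ℝ ℂ) (p.eval 0) = 0 := by
        rw [← Polynomial.eval_map_apply, map_zero]; exact hz
      have := Polynomial.dvd_iff_isRoot.2 ((map_eq_zero (algebraMap ℝ ℂ)).1 h0)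
      simpa using this
  · have h1 : Polynomial.aeval A p = Matrix.vecMulVec
        (fun i => (vecB r ⬝ᵥ Polynomial.aeval A p i) / (vecB r ⬝ᵥ ν)) ν := by
      ext i j
      have := eq_smul_of_vecMul_matA hν hBν (x := Polynomial.aeval A p i)
        (by
          have h := congrFun hpA i
          rwa [Matrix.mul_apply_eq_vecMul] at h)
      have := congrFun this j
      simpa [Matrix.vecMulVec_apply] using this
    rw [← h1]
    have h2 : toC A = (algebraMap ℝ ℂ).mapMatrix A := rfl
    rw [Polynomial.aeval_map_algebraMap]
    exact Polynomial.aeval_algHom_apply ((Algebra.ofId ℝ ℂ).mapMatrix) A p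

/-- On ker A the matrix q(A) acts as the scalar q(0), non-zero because 0 is not a stable root, while
q(A) = yνᵀ annihilates x. -/
lemma eq_zero_of_toC_matA_mulVec_eq_zero (hA : SingleZeroOthersStable (matA r b))
    (hν : Matrix.vecMul ν (matA r b) = 0) (hBν : 0 < vecB r ⬝ᵥ ν) {x : Fin r → ℂ}
    (hx : toC (matA r b) *ᵥ x = 0) (hνx : (fun i => (ν i : ℂ)) ⬝ᵥ x = 0) : x = 0 := by
  obtain ⟨q, y, hq, -, hqA⟩ := exists_stable_cofactor hA hν hBν
  have h1 : Polynomial.aeval (toC (matA r b)) q *ᵥ x = q.coeff 0 • x := by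
    conv_lhs => rw [← Polynomial.divX_mul_X_add q]
    rw [map_add, map_mul, Polynomial.aeval_X, Polynomial.aeval_C, Matrix.add_mulVec,
      ← Matrix.mulVec_mulVec, hx, Matrix.mulVec_zero, zero_add,
      Algebra.algebraMap_eq_smul_one, Matrix.smul_mulVec, Matrix.one_mulVec]
  have h2 : toC (Matrix.vecMulVec y ν) *ᵥ x = 0 := by
    ext i
    have : (toC (Matrix.vecMulVec y ν) *ᵥ x) i = y i * ((fun i => (ν i : ℂ)) ⬝ᵥ x) := by
      simp [Matrix.mulVec, dotProduct, Matrix.vecMulVec_apply, Finset.mul_sum, mul_assoc]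
    rw [this, hνx, mul_zero, Pi.zero_apply]
  rw [hqA, h2] at h1
  refine (smul_eq_zero.1 h1.symm).resolve_left fun h0 => ?_
  have := hq 0 (by rw [Polynomial.IsRoot.def, ← Polynomial.coeff_zero_eq_eval_zero, h0])
  simp at this

lemma nu_dotProduct_toC_matA_mulVec (hν : Matrix.vecMul ν (matA r b) = 0) (x : Fin r → ℂ) :
    (fun i => (ν i : ℂ)) ⬝ᵥ (toC (matA r b) *ᵥ x) = 0 := by
  rw [Matrix.dotProduct_mulVec]
  have : (fun i => (ν i : ℂ)) ᵥ* toC (matA r b) = 0 := by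
    ext j
    have h := congrArg (algebraMap ℝ ℂ) (congrFun hν j)
    simpa [Matrix.vecMul, dotProduct] using h
  rw [this, zero_dotProduct]

lemma ofReal_dotProduct {ι : Type*} [Fintype ι] (u v : ι → ℝ) :
    (fun i => (u i : ℂ)) ⬝ᵥ (fun i => (v i : ℂ)) = ((u ⬝ᵥ v : ℝ) : ℂ) := by
  simp [dotProduct]

lemma toC_sub_smul_vecMulVec_mulVec (A : Matrix (Fin r) (Fin r) ℝ) (k : ℝ) (B v : Fin r → ℝ)
    (x : Fin r → ℂ) :
    toC (A - k • Matrix.vecMulVec B v) *ᵥ x =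
      toC A *ᵥ x - (k * ((fun i => (v i : ℂ)) ⬝ᵥ x)) • fun i => (B i : ℂ) := by
  ext i
  simp only [Matrix.mulVec, dotProduct, Matrix.map_apply, Matrix.sub_apply, Matrix.smul_apply,
    Matrix.vecMulVec_apply, Pi.sub_apply, Pi.smul_apply, smul_eq_mul, map_sub, map_mul, sub_mul,
    Finset.sum_sub_distrib, Finset.mul_sum, Finset.sum_mul, Complex.coe_algebraMap]
  congr 1
  exact Finset.sum_congr rfl fun j _ => by ring

/-- The rank-one feedback `-k νᵀ` makes `A` Hurwitz. -/
lemma re_neg_of_mem_eigs_sub (hA : SingleZeroOthersStable (matA r b))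
    (hν : Matrix.vecMul ν (matA r b) = 0) (hBν : 0 < vecB r ⬝ᵥ ν) {k : ℝ} (hk : 0 < k) {z : ℂ}
    (hz : z ∈ eigs (matA r b - k • Matrix.vecMulVec (vecB r) ν)) : z.re < 0 := by
  obtain ⟨x, hx, hxz⟩ := mem_eigs_iff.1 hz
  rw [toC_sub_smul_vecMulVec_mulVec] at hxz
  -- Projecting on ν gives z (νᵀx) = -k(Bᵀν)(νᵀx). Either this fixes z, or νᵀx = 0 and x does not
  -- feel the feedback, so z is an eigenvalue of A, and not 0.
  have h1 := congrArg (fun y => (fun i => (ν i : ℂ)) ⬝ᵥ y) hxz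
  simp only [dotProduct_sub, dotProduct_smul, nu_dotProduct_toC_matA_mulVec hν,
    ofReal_dotProduct, smul_eq_mul, zero_sub] at h1
  by_cases hw : (fun i => (ν i : ℂ)) ⬝ᵥ x = 0
  · rw [hw, mul_zero, zero_smul, sub_zero] at hxz
    refine hA.2 z (mem_eigs_iff.2 ⟨x, hx, hxz⟩) ?_
    rintro rfl
    exact hx (eq_zero_of_toC_matA_mulVec_eq_zero hA hν hBν (by rw [hxz, zero_smul]) hw)
  · have h2 : z = ((-(k * (vecB r ⬝ᵥ ν)) : ℝ) : ℂ) := by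
      apply mul_right_cancel₀ hw
      rw [← h1, dotProduct_comm ν]
      push_cast
      ring
    rw [h2, Complex.ofReal_re]
    have := mul_pos hk hBν
    linarith

end Companion

/-! ### The Riccati equation -/

section Riccati

open scoped ComplexOrder MatrixOrder Matrix.Norms.L2Operator

/-- Sylvester's argument: D p(X) = p(Y) D for every polynomial p. For the characteristic polynomial
of X the left side is 0, and p(Y) is invertible by spectral mapping. -/
lemma eq_zero_of_mul_eq_mul {ι : Type*} [Fintype ι] [DecidableEq ι] {D X Y : Matrix ι ι ℂ}
    (h : D * X = Y * D) (hXY : Disjoint (spectrum ℂ X) (spectrum ℂ Y)) : D = 0 := by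
  rcases isEmpty_or_nonempty ι with hι | hι
  · exact Subsingleton.elim _ _
  have hp : ∀ p : Polynomial ℂ, D * Polynomial.aeval X p = Polynomial.aeval Y p * D := by
    intro p
    induction p using Polynomial.induction_on' with
    | add p q hp hq => rw [map_add, map_add, mul_add, add_mul, hp, hq]
    | monomial n c =>
      simp only [Polynomial.aeval_monomial, Algebra.algebraMap_eq_smul_one, smul_mul_assoc, one_mul,
        mul_smul_comm]
      congr 1
      induction n with
      | zero => simp
      | succ n ih => rw [pow_succ, ← mul_assoc, ih, mul_assoc, h, ← mul_assoc, ← pow_succ]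
  have h0 := hp X.charpoly
  rw [Matrix.aeval_self_charpoly, mul_zero] at h0
  have hu : IsUnit (Polynomial.aeval Y X.charpoly) := by
    rw [← spectrum.zero_notMem_iff ℂ, spectrum.map_polynomial_aeval_of_nonempty _ _
      (spectrum.nonempty_of_isAlgClosed_of_finiteDimensional ℂ Y)]
    rintro ⟨z, hz, hz0⟩
    exact Set.disjoint_left.1 hXY (Matrix.mem_spectrum_iff_isRoot_charpoly.2 hz0) hz
  exact (hu.mul_right_eq_zero).1 h0.symm

variable {r : ℕ} {b : ℕ → ℝ} {ν : Fin r → ℝ} {q₁ rhat : ℝ}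

/-- The terms linear in P vanish because νᵀA = 0, so only the scalar equation `hc` remains. -/
lemma isRiccatiSolution_rankOne (hν : Matrix.vecMul ν (matA r b) = 0) {c : ℝ}
    (hc : rhat * (c * (vecB r ⬝ᵥ ν)) ^ 2 = q₁) :
    IsRiccatiSolution (matA r b) (vecB r) (q₁ • Matrix.vecMulVec ν ν) rhat
      (c • Matrix.vecMulVec ν ν) := by
  have h1 : Matrix.vecMulVec ν ν * matA r b = 0 := by
    rw [Matrix.vecMulVec_mul, hν, Matrix.vecMulVec_zero]
  have h2 : (matA r b)ᵀ * Matrix.vecMulVec ν ν = 0 := by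
    rw [Matrix.mul_vecMulVec, Matrix.mulVec_transpose, hν, Matrix.zero_vecMulVec]
  rw [IsRiccatiSolution, Matrix.smul_mul, Matrix.mul_smul, h1, h2, Matrix.smul_mul, Matrix.smul_mul,
    Matrix.mul_smul, Matrix.vecMulVec_mul_vecMulVec, Matrix.vecMulVec_smul, Matrix.smul_mul,
    Matrix.vecMulVec_mul_vecMulVec, ← hc, dotProduct_comm ν]
  simp only [Matrix.vecMulVec_smul, smul_smul, smul_zero, zero_add, ← sub_smul]
  rw [show rhat * (c * vecB r ⬝ᵥ ν) ^ 2 - rhat * (c * (c * ((vecB r ⬝ᵥ ν) * (vecB r ⬝ᵥ ν)))) = 0 by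
    ring, zero_smul]

lemma posSemidef_toC {ι : Type*} [Fintype ι] {P : Matrix ι ι ℝ} (hP : P.PosSemidef) :
    (toC P).PosSemidef := by
  classical
  obtain ⟨C, rfl⟩ := CStarAlgebra.nonneg_iff_eq_star_mul_self.mp hP.nonneg
  have : toC (star C * C) = (toC C)ᴴ * toC C := by
    rw [toC, Matrix.map_mul]
    congr 1
    ext i j
    simp
  rw [this]
  exact Matrix.posSemidef_conjTranspose_mul_self _

/-- The closed loop `A - r̂ B Bᵀ P` of a positive semidefinite Riccati solution has no eigenvalue in
the open right half plane, provided `A` has none. -/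
lemma re_nonpos_of_mem_eigs_riccati {A Q P : Matrix (Fin r) (Fin r) ℝ} {B : Fin r → ℝ}
    (hA : ∀ z ∈ eigs A, z.re ≤ 0) (hr : 0 < rhat) (hQ : Q.PosSemidef) (hP : P.PosSemidef)
    (hR : IsRiccatiSolution A B Q rhat P) {z : ℂ}
    (hz : z ∈ eigs (A - rhat • (Matrix.vecMulVec B B * P))) : z.re ≤ 0 := by
  set W := Matrix.vecMulVec B B with hW
  have hWt : Wᵀ = W := Matrix.transpose_vecMulVec _ _
  have hWpos : W.PosSemidef := by simpa using Matrix.posSemidef_vecMulVec_self_star B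
  have hPt : Pᵀ = P := by simpa using hP.1.eq
  set F := A - rhat • (W * P) with hF
  have hFt : Fᵀ = Aᵀ - rhat • (P * W) := by
    rw [hF, Matrix.transpose_sub, Matrix.transpose_smul, Matrix.transpose_mul, hPt, hWt]
  -- Lyapunov form. Tested on an eigenvector x it reads 2 Re(z) x*Px + x*Qx + r̂ (Px)*BBᵀ(Px) = 0.
  -- If Re z > 0, all terms are nonnegative, so BBᵀPx = 0 and x is an eigenvector of A itself.
  have hlyap : P * F + Fᵀ * P + Q + rhat • (P * W * P) = 0 := by
    rw [IsRiccatiSolution, ← hW] at hR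
    rw [hFt, hF, ← hR]
    simp only [mul_sub, sub_mul, mul_smul_comm, smul_mul_assoc, mul_assoc]
    abel
  by_contra! hpos
  obtain ⟨x, hx, hxz⟩ := mem_eigs_iff.1 hz
  have hPC := posSemidef_toC hP
  have hFtC : toC Fᵀ = (toC F)ᴴ := by ext i j; simp
  have hPtC : toC P = (toC P)ᴴ := hPC.1.eq.symm
  have h1 := congrArg (fun M => star x ⬝ᵥ (toC M *ᵥ x)) hlyap
  have hsm : toC (rhat • (P * W * P)) = (rhat : ℂ) • (toC P * toC W * toC P) := by
    rw [toC, Matrix.map_smul' _ _ _ (by simp), Matrix.map_mul, Matrix.map_mul]; rfl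
  have hadd : ∀ M M' : Matrix (Fin r) (Fin r) ℝ, toC (M + M') = toC M + toC M' :=
    fun M M' => Matrix.map_add _ (by simp) M M'
  have hmul : ∀ M M' : Matrix (Fin r) (Fin r) ℝ, toC (M * M') = toC M * toC M' :=
    fun M M' => Matrix.map_mul
  have hz0 : toC (0 : Matrix (Fin r) (Fin r) ℝ) = 0 := by ext; simp
  have e1 : star x ⬝ᵥ (toC P * toC F) *ᵥ x = z * (star x ⬝ᵥ toC P *ᵥ x) := by
    rw [← Matrix.mulVec_mulVec, hxz, Matrix.mulVec_smul, dotProduct_smul, smul_eq_mul]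
  have e2 : star x ⬝ᵥ ((toC F)ᴴ * toC P) *ᵥ x = star z * (star x ⬝ᵥ toC P *ᵥ x) := by
    rw [← Matrix.mulVec_mulVec, Matrix.dotProduct_mulVec, ← Matrix.star_mulVec, hxz, star_smul,
      smul_dotProduct, smul_eq_mul]
  have e3 : star x ⬝ᵥ (toC P * toC W * toC P) *ᵥ x =
      star (toC P *ᵥ x) ⬝ᵥ toC W *ᵥ (toC P *ᵥ x) := by
    rw [← Matrix.mulVec_mulVec, ← Matrix.mulVec_mulVec, Matrix.dotProduct_mulVec, Matrix.star_mulVec,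
      ← hPtC]
  simp only [hadd, hmul, hsm, hz0, hFtC, Matrix.add_mulVec, dotProduct_add, Matrix.smul_mulVec,
    dotProduct_smul, e1, e2, e3, Matrix.zero_mulVec, dotProduct_zero] at h1
  have p1 := (posSemidef_toC hQ).dotProduct_mulVec_nonneg x
  have p2 := hPC.dotProduct_mulVec_nonneg x
  have p3 := (posSemidef_toC hWpos).dotProduct_mulVec_nonneg (toC P *ᵥ x)
  have h2 : toC W *ᵥ (toC P *ᵥ x) = 0 := by
    refine ((posSemidef_toC hWpos).dotProduct_mulVec_zero_iff _).1 ?_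
    rw [Complex.le_def] at p1 p2 p3
    have h3 := congrArg Complex.re h1
    simp only [Complex.add_re, Complex.mul_re, Complex.star_def, Complex.conj_re, Complex.conj_im,
      Complex.zero_re, smul_eq_mul, Complex.ofReal_re, Complex.ofReal_im, zero_mul, sub_zero] at h3
    simp only [Complex.zero_re, Complex.zero_im] at p1 p2 p3
    refine Complex.ext ?_ p3.2.symm
    have h4 := mul_nonneg hpos.le p2.1
    have h5 : rhat * (star (toC P *ᵥ x) ⬝ᵥ toC W *ᵥ (toC P *ᵥ x)).re ≤ 0 := by linarith [p1.1]
    exact le_antisymm (nonpos_of_mul_nonpos_right h5 hr) p3.1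
  refine hpos.not_ge (hA z (mem_eigs_iff.2 ⟨x, hx, ?_⟩))
  have h3 : toC F *ᵥ x = toC A *ᵥ x - (rhat : ℂ) • (toC W *ᵥ (toC P *ᵥ x)) := by
    rw [Matrix.mulVec_mulVec, ← hmul, ← Matrix.smul_mulVec, ← Matrix.sub_mulVec]
    congr 1
    ext i j
    simp only [hF, Matrix.map_apply, Matrix.sub_apply, Matrix.smul_apply, smul_eq_mul, map_sub,
      map_mul, Complex.coe_algebraMap]
  rw [← hxz, h3, h2, smul_zero, sub_zero]

lemma eigs_transpose {ι : Type*} [Fintype ι] [DecidableEq ι] (M : Matrix ι ι ℝ) :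
    eigs Mᵀ = eigs M := by
  ext z
  rw [eigs, eigs, Matrix.mem_spectrum_iff_isRoot_charpoly, Matrix.mem_spectrum_iff_isRoot_charpoly,
    Matrix.transpose_map, Matrix.charpoly_transpose]

lemma neg_mem_eigs_neg {ι : Type*} [Fintype ι] [DecidableEq ι] {M : Matrix ι ι ℝ} {z : ℂ} :
    -z ∈ eigs (-M) ↔ z ∈ eigs M := by
  rw [mem_eigs_iff, mem_eigs_iff]
  have : toC (-M) = -toC M := by ext; simp
  simp [this, Matrix.neg_mulVec]

/-- Subtracting the two Riccati equations gives (P - P₁)F₁ = -Fᵀ(P - P₁) for the closed loops F₁ of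
P₁ and F of P. F₁ is Hurwitz and -Fᵀ has its spectrum in Re ≥ 0, so `eq_zero_of_mul_eq_mul` applies.
-/
lemma riccati_unique (hA : SingleZeroOthersStable (matA r b))
    (hν : Matrix.vecMul ν (matA r b) = 0) (hBν : 0 < vecB r ⬝ᵥ ν) (hq : 0 < q₁) (hr : 0 < rhat)
    {c : ℝ} (hc0 : 0 < c) (hc : rhat * (c * (vecB r ⬝ᵥ ν)) ^ 2 = q₁)
    {P : Matrix (Fin r) (Fin r) ℝ} (hP : P.PosSemidef)
    (hR : IsRiccatiSolution (matA r b) (vecB r) (q₁ • Matrix.vecMulVec ν ν) rhat P) :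
    P = c • Matrix.vecMulVec ν ν := by
  set A := matA r b
  set P₁ := c • Matrix.vecMulVec ν ν with hP₁
  have hR₁ := isRiccatiSolution_rankOne (q₁ := q₁) (b := b) hν hc
  set W := Matrix.vecMulVec (vecB r) (vecB r) with hW
  have hWt : Wᵀ = W := Matrix.transpose_vecMulVec _ _
  have hPt : Pᵀ = P := by simpa using hP.1.eq
  have hAc : A - rhat • (W * P₁) =
      A - (rhat * (c * (vecB r ⬝ᵥ ν))) • Matrix.vecMulVec (vecB r) ν := by
    rw [hP₁, hW, Matrix.mul_smul, Matrix.vecMulVec_mul_vecMulVec, Matrix.vecMulVec_smul, smul_smul,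
      smul_smul]
    ring_nf
  have hS : (P - P₁) * (A - rhat • (W * P₁)) = (-(A - rhat • (W * P))ᵀ) * (P - P₁) := by
    rw [Matrix.transpose_sub, Matrix.transpose_smul, Matrix.transpose_mul, hPt, hWt,
      ← sub_eq_zero]
    have h := congrArg₂ (· - ·) hR hR₁
    simp only [sub_zero, ← hW, ← hP₁] at h
    rw [← h]
    simp only [mul_sub, sub_mul, mul_smul_comm, smul_mul_assoc, mul_assoc, neg_sub,
      smul_sub]
    abel
  have hmul : ∀ M M' : Matrix (Fin r) (Fin r) ℝ, toC (M * M') = toC M * toC M' :=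
    fun M M' => Matrix.map_mul
  have hSC := congrArg toC hS
  rw [hmul, hmul] at hSC
  have hD := eq_zero_of_mul_eq_mul hSC (Set.disjoint_left.2 fun z h1 h2 => by
    have h1' : z.re < 0 := re_neg_of_mem_eigs_sub hA hν hBν (mul_pos hr (mul_pos hc0 hBν))
      (by rw [← hAc]; exact h1)
    have h2' : -z ∈ eigs (A - rhat • (W * P)) := by
      rw [← eigs_transpose, ← neg_mem_eigs_neg, neg_neg]; exact h2
    have hQ : (q₁ • Matrix.vecMulVec ν ν).PosSemidef := by
      simpa using (Matrix.posSemidef_vecMulVec_self_star ν).smul hq.le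
    have := re_nonpos_of_mem_eigs_riccati (fun z hz => by
      by_cases h0 : z = 0
      · simp [h0]
      · exact (hA.2 z hz h0).le) hr hQ hP hR h2'
    rw [Complex.neg_re] at this
    linarith)
  ext i j
  have := congrFun (congrFun hD i) j
  simp only [Matrix.map_apply, Matrix.zero_apply, map_eq_zero, Matrix.sub_apply] at this
  linarith

end Riccati

/-! ### The linearized closed loop -/

section ClosedLoop

variable {N r : ℕ} {b : ℕ → ℝ} {ν : Fin r → ℝ} {a : Matrix (Fin N) (Fin N) ℝ} {κ : ℝ}

lemma kronecker_mulVec {R ι ι' : Type*} [CommRing R] [Fintype ι] [Fintype ι']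
    (L : Matrix ι ι R) (K : Matrix ι' ι' R) (x : ι × ι' → R) (i : ι) (k : ι') :
    ((L ⊗ₖ K) *ᵥ x) (i, k) = ∑ j, L i j * (K *ᵥ fun l => x (j, l)) k := by
  simp [Matrix.mulVec, dotProduct, Fintype.sum_prod_type, Finset.mul_sum, mul_assoc]

lemma one_kronecker_sub_kronecker_mulVec {R ι ι' : Type*} [CommRing R] [Fintype ι] [DecidableEq ι]
    [Fintype ι'] (A : Matrix ι' ι' R) (L : Matrix ι ι R) (c : R) (B v : ι' → R)
    (x : ι × ι' → R) (i : ι) (k : ι') :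
    (((1 : Matrix ι ι R) ⊗ₖ A - L ⊗ₖ (c • Matrix.vecMulVec B v)) *ᵥ x) (i, k) =
      (A *ᵥ fun l => x (i, l)) k - c * (L *ᵥ fun j => v ⬝ᵥ fun l => x (j, l)) i * B k := by
  rw [Matrix.sub_mulVec, Pi.sub_apply, kronecker_mulVec, kronecker_mulVec]
  congr 1
  · simp [Matrix.one_apply]
  · have h : ∀ y : ι' → R, ((c • Matrix.vecMulVec B v) *ᵥ y) k = c * (v ⬝ᵥ y) * B k := by
      intro y
      rw [Matrix.smul_mulVec, Matrix.vecMulVec_mulVec]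
      simp
      ring
    simp only [h]
    rw [Matrix.mulVec, dotProduct, Finset.mul_sum, Finset.sum_mul]
    exact Finset.sum_congr rfl fun j _ => by ring

lemma coopInput_eq (z : Fin N → Fin r → ℝ) (i : Fin N) :
    coopInput a κ ν z i = -κ * (laplacian a *ᵥ fun j => ν ⬝ᵥ z j) i := by
  rw [coopInput, laplacian_mulVec, dotProduct_sum]
  simp [dotProduct_smul, dotProduct_sub]

lemma closedLoopMatrix_mulVec (x : Fin N × Fin r → ℝ) (i : Fin N) (k : Fin r) :
    (closedLoopMatrix r b a κ ν *ᵥ x) (i, k) =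
      (matA r b *ᵥ fun l => x (i, l)) k +
        coopInput a κ ν (fun j l => x (j, l)) i * vecB r k := by
  rw [closedLoopMatrix, one_kronecker_sub_kronecker_mulVec, coopInput_eq]
  ring

lemma toC_closedLoopMatrix_mulVec (x : Fin N × Fin r → ℂ) (i : Fin N) (k : Fin r) :
    (toC (closedLoopMatrix r b a κ ν) *ᵥ x) (i, k) =
      (toC (matA r b) *ᵥ fun l => x (i, l)) k -
        κ * (toC (laplacian a) *ᵥ fun j => (fun l => (ν l : ℂ)) ⬝ᵥ fun l => x (j, l)) i *
          (vecB r k : ℂ) := by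
  have : toC (closedLoopMatrix r b a κ ν) = (1 : Matrix (Fin N) (Fin N) ℂ) ⊗ₖ toC (matA r b) -
      toC (laplacian a) ⊗ₖ ((κ : ℂ) • Matrix.vecMulVec (fun l => (vecB r l : ℂ))
        (fun l => (ν l : ℂ))) := by
    ext ⟨i, k⟩ ⟨j, l⟩
    simp only [closedLoopMatrix, Matrix.map_apply, Matrix.sub_apply, Matrix.kroneckerMap_apply,
      Matrix.smul_apply, Matrix.vecMulVec_apply, smul_eq_mul, map_sub, map_mul, Matrix.one_apply,
      Complex.coe_algebraMap]
    split_ifs <;> simp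
  rw [this, one_kronecker_sub_kronecker_mulVec]

/-- For an eigenvector x, the projections w_i = νᵀx_i satisfy z w = -κ(Bᵀν) L w. If w = 0, the
coupling disappears and each non-zero block is an eigenvector of A. Conversely, an eigenvector of A
for z ≠ 0 is orthogonal to ν and can be copied to all agents; eigenvalues of L are lifted by a
tensor u ⊗ y. -/
lemma mem_eigs_closedLoopMatrix (hν : Matrix.vecMul ν (matA r b) = 0) (hBν : 0 < vecB r ⬝ᵥ ν)
    (hκ : 0 < κ) [Nonempty (Fin N)] {z : ℂ} (hz : z ≠ 0) :
    z ∈ eigs (closedLoopMatrix r b a κ ν) ↔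
      (∃ l ∈ eigs (laplacian a), z = ((-(κ * (vecB r ⬝ᵥ ν)) : ℝ) : ℂ) * l) ∨
        z ∈ eigs (matA r b) := by
  set β := vecB r ⬝ᵥ ν with hβ
  have hc : 0 < κ * β := mul_pos hκ hBν
  have hcC : ((-(κ * β) : ℝ) : ℂ) ≠ 0 := by exact_mod_cast (neg_lt_zero.2 hc).ne
  set nC : Fin r → ℂ := fun l => (ν l : ℂ) with hnC
  set bC : Fin r → ℂ := fun l => (vecB r l : ℂ) with hbC
  have hnb : nC ⬝ᵥ bC = β := by rw [hnC, hbC, ofReal_dotProduct, dotProduct_comm]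
  have hnA : ∀ x, nC ⬝ᵥ (toC (matA r b) *ᵥ x) = 0 := nu_dotProduct_toC_matA_mulVec hν
  have hM : ∀ x i k, (toC (closedLoopMatrix r b a κ ν) *ᵥ x) (i, k) =
      (toC (matA r b) *ᵥ fun l => x (i, l)) k -
        κ * (toC (laplacian a) *ᵥ fun j => nC ⬝ᵥ fun l => x (j, l)) i * bC k :=
    toC_closedLoopMatrix_mulVec
  constructor
  · intro h
    obtain ⟨x, hx, hxz⟩ := mem_eigs_iff.1 h
    set w : Fin N → ℂ := fun j => nC ⬝ᵥ fun l => x (j, l) with hw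
    have hrow : ∀ i, z • (fun l => x (i, l)) = toC (matA r b) *ᵥ (fun l => x (i, l)) -
        (κ * (toC (laplacian a) *ᵥ w) i) • bC := by
      intro i
      ext k
      have := congrFun hxz (i, k)
      rw [hM] at this
      exact this.symm
    have hLw : toC (laplacian a) *ᵥ w = (z / ((-(κ * β) : ℝ) : ℂ)) • w := by
      ext i
      have := congrArg (fun y => nC ⬝ᵥ y) (hrow i)
      simp only [dotProduct_smul, dotProduct_sub, hnA, hnb, smul_eq_mul, zero_sub] at this
      rw [Pi.smul_apply, smul_eq_mul, div_mul_eq_mul_div, eq_div_iff hcC]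
      change z * w i = _ at this
      rw [this]
      push_cast
      ring
    by_cases hw0 : w = 0
    · right
      obtain ⟨⟨i, k⟩, hik⟩ := Function.ne_iff.1 hx
      refine mem_eigs_iff.2 ⟨fun l => x (i, l), fun h0 => hik (congrFun h0 k), ?_⟩
      rw [hrow i, hw0]
      simp
    · left
      exact ⟨_, mem_eigs_iff.2 ⟨w, hw0, hLw⟩, (mul_div_cancel₀ z hcC).symm⟩
  · intro h
    by_cases hzA : z ∈ eigs (matA r b)
    · obtain ⟨y, hy, hyz⟩ := mem_eigs_iff.1 hzA
      have hny : nC ⬝ᵥ y = 0 := by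
        have := hnA y
        rw [hyz, dotProduct_smul, smul_eq_mul] at this
        exact (mul_eq_zero.1 this).resolve_left hz
      refine mem_eigs_iff.2 ⟨fun p => y p.2, ?_, ?_⟩
      · obtain ⟨k, hk⟩ := Function.ne_iff.1 hy
        exact Function.ne_iff.2 ⟨(Classical.arbitrary _, k), hk⟩
      · ext ⟨i, k⟩
        rw [hM]
        have h0 : (fun _ : Fin N => nC ⬝ᵥ fun l => y l) = 0 := funext fun _ => hny
        have h1 := congrFun hyz k
        simp only [h0, Matrix.mulVec_zero, Pi.zero_apply, mul_zero, zero_mul, sub_zero]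
        exact h1
    · obtain ⟨l, hl, rfl⟩ := h.resolve_right hzA
      set z := ((-(κ * β) : ℝ) : ℂ) * l with hzdef
      obtain ⟨u, hu, hul⟩ := mem_eigs_iff.1 hl
      -- Off the spectrum of A the resolvent exists; y = (z - A)⁻¹B satisfies z νᵀy = Bᵀν, the
      -- normalization that makes u ⊗ y an eigenvector.
      have hunit : IsUnit (z • (1 : Matrix (Fin r) (Fin r) ℂ) - toC (matA r b)) := by
        have := spectrum.notMem_iff.1 hzA
        rwa [Algebra.algebraMap_eq_smul_one] at this
      obtain ⟨y, hy⟩ := (Matrix.mulVec_surjective_iff_isUnit.2 hunit) bC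
      rw [Matrix.sub_mulVec, Matrix.smul_mulVec, Matrix.one_mulVec] at hy
      have hny : z * (nC ⬝ᵥ y) = β := by
        have := congrArg (fun y => nC ⬝ᵥ y) hy
        simpa only [dotProduct_sub, dotProduct_smul, hnA, hnb, sub_zero, smul_eq_mul] using this
      have hβC : (β : ℂ) ≠ 0 := by exact_mod_cast hBν.ne'
      have hy0 : y ≠ 0 := by
        rintro rfl
        rw [dotProduct_zero, mul_zero] at hny
        exact hβC hny.symm
      refine mem_eigs_iff.2 ⟨fun p => u p.1 * y p.2, ?_, ?_⟩
      · obtain ⟨k, hk⟩ := Function.ne_iff.1 hy0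
        obtain ⟨i, hi⟩ := Function.ne_iff.1 hu
        exact Function.ne_iff.2 ⟨(i, k), mul_ne_zero hi hk⟩
      · ext ⟨i, k⟩
        rw [hM]
        have h0 : (fun j : Fin N => nC ⬝ᵥ fun l => u j * y l) = (nC ⬝ᵥ y) • u := by
          ext j
          change nC ⬝ᵥ (u j • y) = _
          rw [dotProduct_smul]
          simp [mul_comm]
        have h1 : (toC (matA r b) *ᵥ fun l => u i * y l) k =
            u i * (z * y k - bC k) := by
          change (toC (matA r b) *ᵥ (u i • y)) k = _
          rw [Matrix.mulVec_smul, ← hy]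
          simp
        simp only [h0, h1, Matrix.mulVec_smul, hul, Pi.smul_apply, smul_eq_mul]
        have h2 : (κ : ℂ) * (nC ⬝ᵥ y * (l * u i)) = - u i := by
          have h3 : (β : ℂ) * (κ * (nC ⬝ᵥ y * (l * u i))) = (β : ℂ) * (- u i) := by
            rw [hzdef] at hny
            push_cast at hny
            linear_combination (-u i) * hny
          exact mul_left_cancel₀ hβC h3
        rw [h2]
        ring

lemma consensusSpeed_closedLoopMatrix (ha : ∀ i j, 0 ≤ a i j)
    (hA : SingleZeroOthersStable (matA r b))
    (hν : Matrix.vecMul ν (matA r b) = 0) (hBν : 0 < vecB r ⬝ᵥ ν)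
    (hκ : 0 < κ) [Nonempty (Fin N)] :
    consensusSpeed (closedLoopMatrix r b a κ ν) =
      min (((κ * (vecB r ⬝ᵥ ν) : ℝ) : EReal) * reLamMin (laplacian a))
        (reLamMin (-matA r b)) := by
  set c := κ * (vecB r ⬝ᵥ ν) with hcdef
  have hc : 0 < c := mul_pos hκ hBν
  have hcE : (0 : EReal) < (c : EReal) := by exact_mod_cast hc
  have hne : ∀ z : ℂ, z.re ≠ 0 → z ≠ 0 := fun z hz h => hz (by simp [h])
  have hre : ∀ l : ℂ, (((-c : ℝ) : ℂ) * l).re = -(c * l.re) := fun l => by simp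
  apply le_antisymm
  · refine le_min ?_ ?_
    -- Dividing by the positive finite factor exposes the infimum, also when it is over the empty
    -- set.
    · rw [← EReal.div_le_iff_le_mul hcE (EReal.coe_ne_top c)]
      refine le_iInf₂ fun l hl => ?_
      rw [EReal.div_le_iff_le_mul hcE (EReal.coe_ne_top c)]
      have hlpos := re_pos_of_mem_eigs_laplacian ha hl.1 (hne l hl.2)
      have h1 : (((-c : ℝ) : ℂ) * l).re ≠ 0 := by
        rw [hre]; exact (neg_lt_zero.2 (mul_pos hc hlpos)).ne
      refine (iInf₂_le (((-c : ℝ) : ℂ) * l)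
        ⟨(mem_eigs_closedLoopMatrix hν hBν hκ (hne _ h1)).2 (Or.inl ⟨l, hl.1, rfl⟩), h1⟩).trans ?_
      rw [hre, abs_neg, abs_of_pos (mul_pos hc hlpos), EReal.coe_mul]
    · refine le_iInf₂ fun z hz => ?_
      have h1 : (-z).re ≠ 0 := by simpa using hz.2
      have h2 : -z ∈ eigs (matA r b) := by rw [← neg_mem_eigs_neg, neg_neg]; exact hz.1
      have h3 := hA.2 _ h2 (hne _ h1)
      refine (iInf₂_le (-z)
        ⟨(mem_eigs_closedLoopMatrix hν hBν hκ (hne _ h1)).2 (Or.inr h2), h1⟩).trans ?_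
      rw [abs_of_neg h3, Complex.neg_re, neg_neg]
  · refine le_iInf₂ fun z hz => ?_
    rcases (mem_eigs_closedLoopMatrix hν hBν hκ (hne _ hz.2)).1 hz.1 with ⟨l, hl, rfl⟩ | h
    · have hl0 : l.re ≠ 0 := by
        intro h0
        apply hz.2
        rw [hre, h0]; simp
      have hlpos := re_pos_of_mem_eigs_laplacian ha hl (hne l hl0)
      refine (min_le_left _ _).trans ?_
      rw [hre, abs_neg, abs_of_pos (mul_pos hc hlpos), EReal.coe_mul]
      exact mul_le_mul_of_nonneg_left (iInf₂_le l ⟨hl, hl0⟩) hcE.le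
    · have h3 := hA.2 _ h (hne _ hz.2)
      refine (min_le_right _ _).trans ((iInf₂_le (-z)
        ⟨neg_mem_eigs_neg.2 h, by simpa using hz.2⟩).trans ?_)
      rw [abs_of_neg h3, Complex.neg_re]

/-- The linearized closed loop reaches consensus. -/
lemma tendsto_sub_of_linear_closedLoop (ha : ∀ i j, 0 ≤ a i j) (hG : HasSpanningTree a)
    (hA : SingleZeroOthersStable (matA r b))
    (hν : Matrix.vecMul ν (matA r b) = 0) (hBν : 0 < vecB r ⬝ᵥ ν) (hκ : 0 < κ)
    {z : ℝ → Fin N → Fin r → ℝ}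
    (hz : ∀ t, 0 ≤ t → ∀ i, HasDerivWithinAt (fun t => z t i)
      (matA r b *ᵥ z t i + coopInput a κ ν (z t) i • vecB r) (Ici 0) t) (i j : Fin N) :
    Tendsto (fun t => z t i - z t j) atTop (𝓝 0) := by
  set w : ℝ → Fin N → ℝ := fun t i => ν ⬝ᵥ z t i with hw
  have hw' : ∀ t, 0 ≤ t → HasDerivWithinAt w
      (-(κ * (vecB r ⬝ᵥ ν)) • (laplacian a *ᵥ w t)) (Ici 0) t := by
    intro t ht
    refine hasDerivWithinAt_pi.2 fun i => ?_
    have h1 : HasDerivWithinAt (fun t => w t i)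
        (ν ⬝ᵥ (matA r b *ᵥ z t i + coopInput a κ ν (z t) i • vecB r)) (Ici 0) t := by
      have h0 := hasDerivWithinAt_pi.1 (hz t ht i)
      exact HasDerivWithinAt.fun_sum fun k _ => (h0 k).const_mul (ν k)
    refine h1.congr_deriv ?_
    rw [dotProduct_add, Matrix.dotProduct_mulVec, hν, zero_dotProduct, dotProduct_smul,
      coopInput_eq, dotProduct_comm ν, Pi.smul_apply, smul_eq_mul, smul_eq_mul]
    ring
  have hL := tendsto_laplacian_flow ha hG (mul_pos hκ hBν) hw'
  have hww := tendsto_sub_of_tendsto_laplacian_mulVec ha hG hL i j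
  have hv : ∀ i, Tendsto (fun t => coopInput a κ ν (z t) i) atTop (𝓝 0) := by
    intro i
    simp only [coopInput_eq]
    simpa using ((tendsto_pi_nhds.1 hL) i).const_mul (-κ)
  -- The difference of two agents obeys e' = A e + (vanishing input), and q(A)e = y (w_i - w_j) → 0.
  obtain ⟨q, y, hq, hq0, hqA⟩ := exists_stable_cofactor hA hν hBν
  have hE : Tendsto (fun t k => ((z t i k - z t j k : ℝ) : ℂ)) atTop (𝓝 0) := by
    refine tendsto_zero_of_aeval (toC (matA r b)) _ q hq0 rfl hq
      (d := fun t k => (((coopInput a κ ν (z t) i - coopInput a κ ν (z t) j) * vecB r k : ℝ) : ℂ))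
      (fun t ht => ?_) ?_ ?_
    · refine hasDerivWithinAt_pi.2 fun k => ?_
      have h1 := ((hasDerivWithinAt_pi.1 (hz t ht i)) k).sub ((hasDerivWithinAt_pi.1 (hz t ht j)) k)
      refine h1.ofReal_comp.congr_deriv ?_
      have h2 := congrFun (toC_mulVec_ofReal (matA r b) (z t i - z t j)) k
      simp only [Pi.sub_apply] at h2
      change _ = (toC (matA r b) *ᵥ _) k + _
      rw [h2, Matrix.mulVec_sub]
      simp only [Pi.add_apply, Pi.sub_apply, Pi.smul_apply, smul_eq_mul]
      push_cast
      ring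
    · rw [tendsto_pi_nhds]
      intro k
      have := (((hv i).sub (hv j)).mul_const (vecB r k))
      simp only [sub_zero, zero_mul] at this
      simpa [Function.comp_def] using (Complex.continuous_ofReal.tendsto 0).comp this
    · rw [hqA, tendsto_pi_nhds]
      intro k
      have := (hww.const_mul (y k))
      rw [mul_zero] at this
      have := (Complex.continuous_ofReal.tendsto 0).comp this
      rw [Complex.ofReal_zero] at this
      refine this.congr fun t => ?_
      have h2 := congrFun (toC_mulVec_ofReal (Matrix.vecMulVec y ν) (z t i - z t j)) k
      simp only [Pi.sub_apply] at h2
      rw [h2, Matrix.vecMulVec_mulVec]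
      simp [hw, dotProduct_sub]
  rw [tendsto_pi_nhds] at hE ⊢
  intro k
  simpa [Function.comp_def] using (Complex.continuous_re.tendsto _).comp (hE k)

end ClosedLoop

/-! ### Global solutions of input-to-state stable systems -/

section ISS

open scoped NNReal

/-- Componentwise truncation of a vector to `[-R, R]`. -/
noncomputable def clampVec {m : ℕ} (R : ℝ) (v : EuclideanSpace ℝ (Fin m)) :
    EuclideanSpace ℝ (Fin m) :=
  WithLp.toLp 2 fun k => max (-R) (min R (v k))

lemma dist_clampVec_le {m : ℕ} (R : ℝ) (u v : EuclideanSpace ℝ (Fin m)) :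
    dist (clampVec R u) (clampVec R v) ≤ dist u v := by
  rw [EuclideanSpace.dist_eq, EuclideanSpace.dist_eq]
  refine Real.sqrt_le_sqrt (Finset.sum_le_sum fun k _ => ?_)
  refine pow_le_pow_left₀ dist_nonneg ?_ 2
  rw [Real.dist_eq, Real.dist_eq]
  refine (abs_max_sub_max_le_max _ _ _ _).trans ?_
  rw [sub_self, abs_zero]
  refine max_le (abs_nonneg _) ((abs_min_sub_min_le_max _ _ _ _).trans ?_)
  rw [sub_self, abs_zero]
  exact max_le (abs_nonneg _) le_rfl

lemma clampVec_of_norm_le {m : ℕ} {R : ℝ} {v : EuclideanSpace ℝ (Fin m)} (hv : ‖v‖ ≤ R) :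
    clampVec R v = v := by
  ext k
  have h := abs_le.1 ((Real.norm_eq_abs (v k) ▸ PiLp.norm_apply_le v k).trans hv)
  change max (-R) (min R (v k)) = v k
  rw [min_eq_right h.2, max_eq_right h.1]

lemma norm_clampVec_le {m : ℕ} {R : ℝ} (hR : 0 ≤ R) (v : EuclideanSpace ℝ (Fin m)) :
    ‖clampVec R v‖ ≤ √(∑ _k : Fin m, R ^ 2) := by
  rw [EuclideanSpace.norm_eq]
  refine Real.sqrt_le_sqrt (Finset.sum_le_sum fun k _ => ?_)
  refine pow_le_pow_left₀ (norm_nonneg _) ?_ 2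
  rw [Real.norm_eq_abs]
  change |max (-R) (min R (v k))| ≤ R
  rw [abs_le]
  exact ⟨le_max_left _ _, max_le (by linarith) (min_le_left _ _)⟩

variable {ρ m : ℕ} {ϑ : (Fin ρ → ℝ) × EuclideanSpace ℝ (Fin m) → EuclideanSpace ℝ (Fin m)}
  {ξ : ℝ → Fin ρ → ℝ}

lemma exists_lipschitzOnWith_closedBall (hϑ : LocallyLipschitz ϑ) (M C : ℝ) :
    ∃ K L : ℝ≥0, LipschitzOnWith K ϑ (Metric.closedBall 0 M ×ˢ Metric.closedBall 0 C) ∧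
      ∀ p ∈ Metric.closedBall 0 M ×ˢ Metric.closedBall 0 C, ‖ϑ p‖ ≤ L := by
  have hcomp : IsCompact (Metric.closedBall (0 : Fin ρ → ℝ) M ×ˢ
      Metric.closedBall (0 : EuclideanSpace ℝ (Fin m)) C) :=
    (isCompact_closedBall _ _).prod (isCompact_closedBall _ _)
  obtain ⟨K, hK⟩ :=
    LocallyLipschitzOn.exists_lipschitzOnWith_of_compact hcomp hϑ.locallyLipschitzOn
  obtain ⟨L, hL⟩ := hcomp.exists_bound_of_continuousOn hϑ.continuous.continuousOn
  exact ⟨K, L.toNNReal, hK, fun p hp => (hL p hp).trans (Real.le_coe_toNNReal L)⟩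

/-- Clamping η keeps the right-hand side bounded by L and Lipschitz in η on all of [0, T], so
Picard–Lindelöf on a ball of radius L·T covers the whole interval. -/
lemma exists_solution_clamped (hϑ : LocallyLipschitz ϑ) (hξ : Continuous ξ)
    (η₀ : EuclideanSpace ℝ (Fin m)) {R T : ℝ} (hR : 0 ≤ R) (hT : 0 ≤ T) :
    ∃ η : ℝ → EuclideanSpace ℝ (Fin m), η 0 = η₀ ∧ ∀ t ∈ Icc 0 T,
      HasDerivWithinAt η (ϑ (ξ t, clampVec R (η t))) (Icc 0 T) t := by
  obtain ⟨M, hM⟩ := isCompact_Icc.exists_bound_of_continuousOn (s := Icc 0 T) hξ.continuousOn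
  obtain ⟨K, L, hK, hL⟩ := exists_lipschitzOnWith_closedBall hϑ M (√(∑ _k : Fin m, R ^ 2))
  have hmem : ∀ t ∈ Icc 0 T, ∀ v, (ξ t, clampVec R v) ∈
      Metric.closedBall (0 : Fin ρ → ℝ) M ×ˢ Metric.closedBall 0 (√(∑ _k : Fin m, R ^ 2)) :=
    fun t ht v => ⟨by simpa using hM t ht, by simpa using norm_clampVec_le hR v⟩
  have hPL : IsPicardLindelof (fun t v => ϑ (ξ t, clampVec R v))
      (⟨0, le_rfl, hT⟩ : Icc 0 T) η₀ (L * T.toNNReal) 0 L K :=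
    { lipschitzOnWith := fun t ht => LipschitzOnWith.of_dist_le_mul fun u _ v _ => by
        refine (hK.dist_le_mul _ (hmem t ht u) _ (hmem t ht v)).trans ?_
        refine mul_le_mul_of_nonneg_left ?_ K.2
        rw [Prod.dist_eq, dist_self]
        exact max_le dist_nonneg (dist_clampVec_le R u v)
      continuousOn := fun v _ =>
        (hϑ.continuous.comp (hξ.prodMk continuous_const)).continuousOn
      norm_le := fun t ht v _ => hL _ (hmem t ht v)
      mul_max_le := by simp [hT] }
  exact hPL.exists_eq_forall_mem_Icc_hasDerivWithinAt₀

/-- Continuation by an a priori bound: clamp at a level R above the stability bound R₀. While ‖η‖ ≤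
R the clamp is inactive, so ‖η‖ ≤ R₀ < R, and R is never reached. -/
lemma exists_solution_Icc (hϑ : LocallyLipschitz ϑ) (hISS : IsISS ϑ) (hξ : Continuous ξ)
    (η₀ : EuclideanSpace ℝ (Fin m)) {T : ℝ} (hT : 0 ≤ T) :
    ∃ η : ℝ → EuclideanSpace ℝ (Fin m), η 0 = η₀ ∧ ∀ t ∈ Icc 0 T,
      HasDerivWithinAt η (ϑ (ξ t, η t)) (Icc 0 T) t := by
  obtain ⟨M, hM⟩ := isCompact_Icc.exists_bound_of_continuousOn (s := Icc 0 T) hξ.continuousOn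
  obtain ⟨γ₁, γ₂, h₁, -, hγ⟩ := hISS
  set R₀ := γ₁ ‖η₀‖ 0 + γ₂ M with hR₀
  set R := |R₀| + 1
  obtain ⟨η, hη0, hη⟩ := exists_solution_clamped hϑ hξ η₀ (R := R) (by positivity) hT
  have hcont : ContinuousOn η (Icc 0 T) := fun t ht => (hη t ht).continuousWithinAt
  have hbound : ∀ s ∈ Icc 0 T, (∀ t ∈ Icc 0 s, ‖η t‖ ≤ R) → ‖η s‖ ≤ R₀ := by
    intro s hs hle
    have hsub : Icc 0 s ⊆ Icc 0 T := Icc_subset_Icc_right hs.2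
    refine (hγ s hs.1 ξ η hξ.continuousOn (fun t ht => ?_) M
      (fun t ht => hM t (hsub ht))).trans ?_
    · have := (hη t (hsub ht)).mono hsub
      rwa [clampVec_of_norm_le (hle t ht)] at this
    · rw [hη0]
      exact add_le_add_left (h₁.antitoneOn _ (norm_nonneg _) (mem_Ici.2 le_rfl) hs.1 hs.1) _
  have hη0R : ‖η 0‖ ≤ R₀ := by
    -- On the degenerate interval [0, 0] a constant function solves the equation, so the stability
    -- estimate itself bounds the initial value by R₀.
    rw [hη0]
    have := hγ 0 le_rfl ξ (fun _ => η₀) hξ.continuousOn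
      (fun t _ => by
        have : Icc (0 : ℝ) 0 = {0} := Icc_self 0
        rw [this]
        have ht : t = 0 := by simp_all
        rw [ht]
        exact hasDerivWithinAt_iff_hasFDerivWithinAt.2 HasFDerivWithinAt.singleton) M
      (fun t ht => hM t (Icc_subset_Icc_right hT ht))
    exact this
  have hall : ∀ t ∈ Icc 0 T, ‖η t‖ ≤ R := by
    by_contra! hex
    obtain ⟨t₁, ht₁, hlt⟩ := hex
    have hsub₁ : Icc 0 t₁ ⊆ Icc 0 T := Icc_subset_Icc_right ht₁.2
    -- Let s be the first time with ‖η‖ ≥ R. The bound R₀ holds on (0, s) and passes to the limit at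
    -- s, a contradiction.
    set S : Set ℝ := Icc 0 t₁ ∩ (fun t => ‖η t‖) ⁻¹' Ici R
    have hScl : IsClosed S :=
      (hcont.mono hsub₁).norm.preimage_isClosed_of_isClosed isClosed_Icc isClosed_Ici
    have hSne : S.Nonempty := ⟨t₁, ⟨ht₁.1, le_rfl⟩, hlt.le⟩
    have hSbdd : BddBelow S := ⟨0, fun t ht => ht.1.1⟩
    set s := sInf S
    have hsS : s ∈ S := hScl.csInf_mem hSne hSbdd
    have hsT : s ∈ Icc 0 T := hsub₁ hsS.1
    have hbefore : ∀ t, 0 ≤ t → t < s → ‖η t‖ < R := by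
      intro t ht hts
      by_contra! h
      exact (csInf_le hSbdd ⟨⟨ht, hts.le.trans hsS.1.2⟩, h⟩).not_gt hts
    have hR : R₀ < R := (le_abs_self R₀).trans_lt (lt_add_one _)
    have hs0 : s ≠ 0 := by
      intro h0
      have : R ≤ ‖η s‖ := hsS.2
      rw [h0] at this
      linarith
    have hspos : 0 < s := lt_of_le_of_ne hsS.1.1 (Ne.symm hs0)
    have hlim : Tendsto (fun t => ‖η t‖) (𝓝[Ioo 0 s] s) (𝓝 ‖η s‖) :=
      ((hcont s hsT).mono fun t ht => ⟨ht.1.le, ht.2.le.trans hsT.2⟩).norm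
    have hne : (𝓝[Ioo 0 s] s).NeBot := right_nhdsWithin_Ioo_neBot hspos
    have hle : ‖η s‖ ≤ R₀ := by
      refine le_of_tendsto hlim ?_
      filter_upwards [self_mem_nhdsWithin] with t ht
      exact hbound t ⟨ht.1.le, ht.2.le.trans hsT.2⟩
        fun u hu => (hbefore u hu.1 (hu.2.trans_lt ht.2)).le
    have : R ≤ ‖η s‖ := hsS.2
    linarith
  refine ⟨η, hη0, fun t ht => ?_⟩
  have := hη t ht
  rwa [clampVec_of_norm_le (hall t ht)] at this

lemma eqOn_of_solution_Icc (hϑ : LocallyLipschitz ϑ) (hξ : Continuous ξ) {T : ℝ}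
    {η η' : ℝ → EuclideanSpace ℝ (Fin m)} (h0 : η 0 = η' 0)
    (hη : ∀ t ∈ Icc 0 T, HasDerivWithinAt η (ϑ (ξ t, η t)) (Icc 0 T) t)
    (hη' : ∀ t ∈ Icc 0 T, HasDerivWithinAt η' (ϑ (ξ t, η' t)) (Icc 0 T) t) :
    EqOn η η' (Icc 0 T) := by
  have hc : ContinuousOn η (Icc 0 T) := fun t ht => (hη t ht).continuousWithinAt
  have hc' : ContinuousOn η' (Icc 0 T) := fun t ht => (hη' t ht).continuousWithinAt
  obtain ⟨M, hM⟩ := isCompact_Icc.exists_bound_of_continuousOn (s := Icc 0 T) hξ.continuousOn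
  obtain ⟨C, hC⟩ := isCompact_Icc.exists_bound_of_continuousOn hc
  obtain ⟨C', hC'⟩ := isCompact_Icc.exists_bound_of_continuousOn hc'
  obtain ⟨K, L, hK, -⟩ := exists_lipschitzOnWith_closedBall hϑ M (max C C')
  refine ODE_solution_unique_of_mem_Icc_right (v := fun t v => ϑ (ξ t, v)) (K := K)
    (s := fun _ => Metric.closedBall 0 (max C C')) (fun t ht => ?_) hc (fun t ht => ?_)
    (fun t ht => ?_) hc' (fun t ht => ?_) (fun t ht => ?_) h0
  · refine LipschitzOnWith.of_dist_le_mul fun u hu v hv => ?_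
    have hξt : ξ t ∈ Metric.closedBall (0 : Fin ρ → ℝ) M := by
      simpa using hM t (Ico_subset_Icc_self ht)
    refine (hK.dist_le_mul (ξ t, u) ⟨hξt, hu⟩ (ξ t, v) ⟨hξt, hv⟩).trans ?_
    rw [Prod.dist_eq, dist_self, max_eq_right dist_nonneg]
  · exact (hη t (Ico_subset_Icc_self ht)).mono_of_mem_nhdsWithin (Icc_mem_nhdsGE_of_mem ht)
  · simpa using Or.inl (hC t (Ico_subset_Icc_self ht))
  · exact (hη' t (Ico_subset_Icc_self ht)).mono_of_mem_nhdsWithin (Icc_mem_nhdsGE_of_mem ht)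
  · simpa using Or.inr (hC' t (Ico_subset_Icc_self ht))

/-- An input-to-state stable system with locally Lipschitz right-hand side has global forward
solutions for every continuous input. -/
lemma exists_global_solution (hϑ : LocallyLipschitz ϑ) (hISS : IsISS ϑ) (hξ : Continuous ξ)
    (η₀ : EuclideanSpace ℝ (Fin m)) :
    ∃ η : ℝ → EuclideanSpace ℝ (Fin m), η 0 = η₀ ∧ ∀ t, 0 ≤ t →
      HasDerivWithinAt η (ϑ (ξ t, η t)) (Ici 0) t := by
  choose F hF0 hF using fun n : ℕ =>
    exists_solution_Icc hϑ hISS hξ η₀ (T := n) (Nat.cast_nonneg n)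
  have hagree : ∀ k n : ℕ, k ≤ n → EqOn (F k) (F n) (Icc 0 k) := by
    intro k n hkn
    have hsub : Icc (0 : ℝ) k ⊆ Icc 0 n := Icc_subset_Icc_right (by exact_mod_cast hkn)
    exact eqOn_of_solution_Icc hϑ hξ (by rw [hF0, hF0]) (hF k)
      fun t ht => (hF n t (hsub ht)).mono hsub
  -- The index ⌊t⌋₊ + 1 leaves t strictly below the right end of its interval, so derivatives within
  -- [0, n] are derivatives within [0, ∞).
  set η : ℝ → EuclideanSpace ℝ (Fin m) := fun t => F (⌊t⌋₊ + 1) t with hη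
  have hηF : ∀ (n : ℕ) (t : ℝ), 0 ≤ t → t < n → η t = F n t := by
    intro n t ht htn
    have h1 : ⌊t⌋₊ + 1 ≤ n := (Nat.floor_lt ht).2 htn
    refine hagree _ _ h1 ⟨ht, ?_⟩
    push_cast
    exact (Nat.lt_floor_add_one t).le
  refine ⟨η, by rw [hη]; exact hF0 _, fun t ht => ?_⟩
  set n := ⌊t⌋₊ + 1
  have htn : t < n := by push_cast [n]; exact Nat.lt_floor_add_one t
  have h1 : HasDerivWithinAt (F n) (ϑ (ξ t, F n t)) (Ici 0) t :=
    (hF n t ⟨ht, htn.le⟩).mono_of_mem_nhdsWithin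
      (mem_nhdsWithin.2 ⟨Iio n, isOpen_Iio, htn, fun s hs => ⟨hs.2, (mem_Iio.1 hs.1).le⟩⟩)
  rw [hηF n t ht htn]
  refine h1.congr_of_eventuallyEq ?_ (hηF n t ht htn)
  exact mem_nhdsWithin.2 ⟨Iio n, isOpen_Iio, htn, fun s hs => hηF n s hs.2 hs.1⟩

end ISS

/-! ### Integrator chains with dynamic controllers -/

section Chain

variable {r ρ : ℕ} {b : ℕ → ℝ}

lemma xiHat_of_lt {ξ : Fin ρ → ℝ} {φ : Fin (r - ρ) → ℝ} {k : Fin r} (hk : (k : ℕ) < ρ) :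
    xiHat ξ φ k = ξ ⟨k, hk⟩ := dif_pos hk

lemma xiHat_of_ge {ξ : Fin ρ → ℝ} {φ : Fin (r - ρ) → ℝ} {k : Fin r} (hk : ¬ (k : ℕ) < ρ) :
    xiHat ξ φ k = φ ⟨k - ρ, by omega⟩ := dif_neg hk

lemma sum_fin_eq_add_of_le {M : Type*} [AddCommMonoid M] (h : ρ ≤ r) (F : Fin r → M) :
    ∑ j, F j = (∑ j : Fin ρ, F ⟨j, by omega⟩) + ∑ j : Fin (r - ρ), F ⟨ρ + j, by omega⟩ := by
  have h' : ρ + (r - ρ) = r := by omega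
  rw [← Fin.sum_congr' F h', Fin.sum_univ_add]
  rfl

lemma sum_eq_of_succ {n : ℕ} (x : Fin n → ℝ) {k : ℕ} (hk : k + 1 < n) :
    (∑ j : Fin n, (if (j : ℕ) = k + 1 then (1 : ℝ) else 0) * x j) = x ⟨k + 1, hk⟩ := by
  rw [Finset.sum_eq_single ⟨k + 1, hk⟩]
  · simp
  · intro j _ hj
    have : (j : ℕ) ≠ k + 1 := fun h => hj (Fin.ext h)
    simp [this]
  · simp

/-- The time derivative of the linearized state of an agent under the input `û`. -/
noncomputable def chainField (b : ℕ → ℝ) (ξ : Fin ρ → ℝ) (φ : Fin (r - ρ) → ℝ) (v : ℝ) :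
    Fin ρ → ℝ :=
  fun k => if h : (k : ℕ) + 1 < ρ then ξ ⟨k + 1, h⟩ else uHat b ξ φ v

/-- The integrator chain of length `ρ` and its dynamic controller form the chain of length `r` with
companion matrix `A` and input `v`. -/
lemma matA_mulVec_xiHat (h0 : 0 < ρ) (hr : ρ ≤ r) (ξ : Fin ρ → ℝ) (φ : Fin (r - ρ) → ℝ) (v : ℝ) :
    matA r b *ᵥ xiHat ξ φ + v • vecB r =
      xiHat (chainField b ξ φ v) (matD r ρ b *ᵥ ξ + matE r ρ b *ᵥ φ + v • vecB (r - ρ)) := by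
  ext k
  rw [Pi.add_apply, Pi.smul_apply, smul_eq_mul]
  by_cases hk : (k : ℕ) + 1 = r
  · have hlast : (matA r b *ᵥ xiHat ξ φ) k =
        (∑ j : Fin ρ, (if (j : ℕ) = 0 then 0 else - b (j + 1)) * ξ j) +
          ∑ j : Fin (r - ρ), -b (ρ + j + 1) * φ j := by
      rw [Matrix.mulVec, dotProduct, sum_fin_eq_add_of_le hr]
      congr 1
      · refine Finset.sum_congr rfl fun j _ => ?_
        rw [xiHat_of_lt (k := ⟨j, j.2.trans_le hr⟩) j.2]
        simp [matA, hk]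
      · refine Finset.sum_congr rfl fun j _ => ?_
        rw [xiHat_of_ge (k := ⟨ρ + j, by omega⟩) (by simp)]
        have : ρ + (j : ℕ) ≠ 0 := by omega
        simp [matA, hk, h0.ne']
    rw [hlast]
    by_cases hkρ : (k : ℕ) < ρ
    -- The last row belongs to ξ only when ρ = r; v then enters through the static û.
    · have hs : ¬ 0 < r - ρ := by omega
      have : IsEmpty (Fin (r - ρ)) := by
        rw [show r - ρ = 0 by omega]; infer_instance
      rw [xiHat_of_lt hkρ, chainField, dif_neg (by simp; omega), uHat, dif_neg hs]
      simp [vecB, hk]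
    · rw [xiHat_of_ge hkρ]
      have hk' : (k : ℕ) - ρ + 1 = r - ρ := by omega
      simp [vecB, hk, hk', matD, matE, Matrix.mulVec, dotProduct]
  · have hk1 : (k : ℕ) + 1 < r := by omega
    have hrow : (matA r b *ᵥ xiHat ξ φ) k = xiHat ξ φ ⟨k + 1, hk1⟩ := by
      rw [Matrix.mulVec, dotProduct, ← sum_eq_of_succ (xiHat ξ φ) hk1]
      simp [matA, hk]
    rw [hrow]
    by_cases hkρ : (k : ℕ) < ρ
    · rw [xiHat_of_lt hkρ, chainField]
      by_cases hk2 : (k : ℕ) + 1 < ρ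
      · rw [xiHat_of_lt (k := ⟨k + 1, hk1⟩) hk2, dif_pos hk2]
        simp [vecB, hk]
      -- Junction k + 1 = ρ: the next coordinate is φ₁ = û, which glues the two chains.
      · rw [xiHat_of_ge (k := ⟨k + 1, hk1⟩) hk2, dif_neg hk2, uHat, dif_pos (by omega)]
        have : (k : ℕ) + 1 - ρ = 0 := by omega
        simp [vecB, hk, this]
    · rw [xiHat_of_ge hkρ, xiHat_of_ge (k := ⟨k + 1, hk1⟩) (by simp; omega)]
      have hk' : (k : ℕ) - ρ + 1 ≠ r - ρ := by omega
      have hk2 : (k : ℕ) - ρ + 1 < r - ρ := by omega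
      have hE : (matE r ρ b *ᵥ φ) ⟨k - ρ, by omega⟩ = φ ⟨k - ρ + 1, hk2⟩ := by
        rw [Matrix.mulVec, dotProduct, ← sum_eq_of_succ φ hk2]
        simp [matE, hk']
      have hD : (matD r ρ b *ᵥ ξ) ⟨k - ρ, by omega⟩ = 0 := by
        simp [Matrix.mulVec, dotProduct, matD, hk']
      rw [Pi.add_apply, Pi.add_apply, hE, hD]
      have : (k : ℕ) + 1 - ρ = k - ρ + 1 := by omega
      simp [vecB, hk, hk', this]

end Chain

/-! ### Normal forms -/

section NormalForm

variable {n r ρ : ℕ} {S : Agent n}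
  {Φ : EuclideanSpace ℝ (Fin n) ≃ (Fin ρ → ℝ) × EuclideanSpace ℝ (Fin (n - ρ))}

/-- These Lie derivatives are coordinates of the C¹ map Φ, which is where their regularity comes
from. -/
lemma IsNormalForm.differentiable_lie (hΦ : IsNormalForm S ρ Φ) {k : ℕ} (hk : k < ρ) :
    Differentiable ℝ (S.lie k) := by
  have h1 : S.lie k = fun x => (Φ x).1 ⟨k, hk⟩ := by
    funext x
    rw [hΦ.fst_eq]
    rfl
  rw [h1]
  exact differentiable_pi.1 (hΦ.contDiff.differentiable one_ne_zero).fst _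

/-- The closed-loop vector field of an agent. -/
noncomputable def agentField (S : Agent n) (ρ : ℕ) (b : ℕ → ℝ) (x : EuclideanSpace ℝ (Fin n))
    (φ : Fin (r - ρ) → ℝ) (v : ℝ) : EuclideanSpace ℝ (Fin n) :=
  S.f x + controlU S ρ b x φ v • S.g x

/-- The input is invisible up to order ρ - 2; at order ρ - 1 it enters with factor β, and u cancels
α to leave û. -/
lemma fderiv_lie_agentField (hρ : S.HasRelativeDegree ρ) (b : ℕ → ℝ)
    (x : EuclideanSpace ℝ (Fin n)) (φ : Fin (r - ρ) → ℝ) (v : ℝ) (k : Fin ρ) :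
    fderiv ℝ (S.lie k) x (agentField S ρ b x φ v) = chainField b (S.xi ρ x) φ v k := by
  have hsucc : ∀ k, fderiv ℝ (S.lie k) x (S.f x) = S.lie (k + 1) x := by
    intro k
    rw [Agent.lie, Agent.lie, Function.iterate_succ_apply']
    rfl
  rw [agentField, map_add, map_smul, hsucc, chainField, smul_eq_mul]
  by_cases hk : (k : ℕ) + 1 < ρ
  · have hg : fderiv ℝ (S.lie k) x (S.g x) = 0 := hρ.2.1 k (by omega) x
    rw [dif_pos hk, hg, mul_zero, add_zero]
    rfl
  · have hk' : ρ - 1 = k := by omega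
    have hβ : S.beta ρ x ≠ 0 := hρ.2.2 x
    have hg : fderiv ℝ (S.lie k) x (S.g x) = S.beta ρ x := by
      rw [Agent.beta, hk']; rfl
    have hα : S.lie (k + 1) x = S.alpha ρ x := by
      rw [Agent.alpha]; congr 1; omega
    rw [dif_neg hk, hg, hα, controlU, div_mul_cancel₀ _ hβ]
    ring

lemma IsNormalForm.fderiv_agentField (hΦ : IsNormalForm S ρ Φ) (hρ : S.HasRelativeDegree ρ)
    (b : ℕ → ℝ) (x : EuclideanSpace ℝ (Fin n)) (φ : Fin (r - ρ) → ℝ) (v : ℝ) :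
    fderiv ℝ Φ x (agentField S ρ b x φ v) =
      (chainField b (S.xi ρ x) φ v, internalField S ρ Φ (Φ x)) := by
  have hd : DifferentiableAt ℝ Φ x := hΦ.contDiff.differentiable one_ne_zero x
  refine Prod.ext ?_ ?_
  · ext k
    have h1 : HasFDerivAt (S.lie k) ((ContinuousLinearMap.proj k).comp
        ((ContinuousLinearMap.fst ℝ _ _).comp (fderiv ℝ Φ x))) x := by
      have h2 := (hasFDerivAt_pi'.1 hd.hasFDerivAt.fst) k
      have h3 : S.lie k = fun x => (Φ x).1 k := by
        funext y
        rw [hΦ.fst_eq]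
        rfl
      rw [h3]
      exact h2
    refine Eq.trans ?_ (fderiv_lie_agentField hρ b x φ v k)
    rw [h1.fderiv]
    rfl
  · have h1 : HasFDerivAt (fun y => (Φ y).2)
        ((ContinuousLinearMap.snd ℝ _ _).comp (fderiv ℝ Φ x)) x := hd.hasFDerivAt.snd
    have h2 : (fderiv ℝ Φ x (agentField S ρ b x φ v)).2 =
        fderiv ℝ (fun y => (Φ y).2) x (agentField S ρ b x φ v) := by
      rw [h1.fderiv]; rfl
    rw [h2, agentField, map_add, map_smul, hΦ.lie_snd, smul_zero, add_zero, internalField,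
      Equiv.symm_apply_apply]

/-- A solution in normal form coordinates, transported back to the original ones. -/
lemma IsNormalForm.hasDerivWithinAt_symm (hΦ : IsNormalForm S ρ Φ) (hρ : S.HasRelativeDegree ρ)
    {b : ℕ → ℝ} {ξ : ℝ → Fin ρ → ℝ} {η : ℝ → EuclideanSpace ℝ (Fin (n - ρ))}
    {φ : Fin (r - ρ) → ℝ} {v : ℝ} {s : Set ℝ} {t : ℝ}
    (hξ : HasDerivWithinAt ξ (chainField b (ξ t) φ v) s t)
    (hη : HasDerivWithinAt η (internalField S ρ Φ (ξ t, η t)) s t) :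
    HasDerivWithinAt (fun t => Φ.symm (ξ t, η t))
      (agentField S ρ b (Φ.symm (ξ t, η t)) φ v) s t := by
  set x := Φ.symm (ξ t, η t) with hx
  have hΦx : Φ x = (ξ t, η t) := Φ.apply_symm_apply _
  have hξx : S.xi ρ x = ξ t := by rw [← hΦ.fst_eq, hΦx]
  have hd : HasFDerivAt Φ (fderiv ℝ Φ x) x :=
    (hΦ.contDiff.differentiable one_ne_zero x).hasFDerivAt
  have hds : HasFDerivAt Φ.symm (fderiv ℝ Φ.symm (ξ t, η t)) (ξ t, η t) :=
    (hΦ.contDiff_symm.differentiable one_ne_zero _).hasFDerivAt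
  -- DΦ sends the agent's field to the normal-form field; its left inverse brings that field back.
  have hcomp : (fderiv ℝ Φ.symm (ξ t, η t)).comp (fderiv ℝ Φ x) =
      ContinuousLinearMap.id ℝ (EuclideanSpace ℝ (Fin n)) := by
    have h1 : HasFDerivAt (Φ.symm ∘ Φ) ((fderiv ℝ Φ.symm (ξ t, η t)).comp (fderiv ℝ Φ x)) x :=
      HasFDerivAt.comp x (by rw [hΦx]; exact hds) hd
    rw [Equiv.symm_comp_self] at h1
    exact h1.unique (hasFDerivAt_id x)
  refine (hds.comp_hasDerivWithinAt t (hξ.prodMk hη)).congr_deriv ?_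
  have h2 := hΦ.fderiv_agentField hρ b x φ v
  rw [hξx, hΦx] at h2
  rw [← h2]
  exact DFunLike.congr_fun hcomp _

end NormalForm

/-! ### Closed-loop trajectories -/

section Trajectories

variable {N r : ℕ} {n : Fin N → ℕ} {S : ∀ i, Agent (n i)} {ρ : Fin N → ℕ}
  {Φ : ∀ i, EuclideanSpace ℝ (Fin (n i)) ≃
    (Fin (ρ i) → ℝ) × EuclideanSpace ℝ (Fin (n i - ρ i))}
  {a : Matrix (Fin N) (Fin N) ℝ} {b : ℕ → ℝ} {ν : Fin r → ℝ} {κ : ℝ}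

lemma exists_linear_solution {ι : Type*} [Fintype ι] (M : Matrix ι ι ℝ) (z₀ : ι → ℝ) :
    ∃ z : ℝ → ι → ℝ, z 0 = z₀ ∧ ∀ t, HasDerivAt z (M *ᵥ z t) t := by
  classical
  set T : (ι → ℝ) →L[ℝ] (ι → ℝ) := LinearMap.toContinuousLinearMap (Matrix.toLin' M)
  refine ⟨fun t => NormedSpace.exp (t • T) z₀, by simp [NormedSpace.exp_zero], fun t => ?_⟩
  have h := (hasDerivAt_exp_smul_const' T t).clm_apply (hasDerivAt_const t z₀)
  simpa [T] using h

/-- The ξ̂ equation is linear and autonomous, so it is solved before η is known; each ξ_i is then a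
continuous input to the internal dynamics. -/
lemma exists_closedLoopSolution (hρ : ∀ i, (S i).HasRelativeDegree (ρ i)) (hr : ∀ i, ρ i ≤ r)
    (hΦ : ∀ i, IsNormalForm (S i) (ρ i) (Φ i))
    (hLip : ∀ i, LocallyLipschitz (internalField (S i) (ρ i) (Φ i)))
    (hISS : ∀ i, IsISS (internalField (S i) (ρ i) (Φ i)))
    (x₀ : ∀ i, EuclideanSpace ℝ (Fin (n i))) (φ₀ : ∀ i, Fin (r - ρ i) → ℝ) :
    ∃ (x : ∀ i, ℝ → EuclideanSpace ℝ (Fin (n i))) (φ : ∀ i, ℝ → Fin (r - ρ i) → ℝ),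
      IsClosedLoopSolution S ρ b a κ ν x φ ∧ (∀ i, x i 0 = x₀ i) ∧ (∀ i, φ i 0 = φ₀ i) := by
  obtain ⟨z, hz0, hz⟩ := exists_linear_solution (closedLoopMatrix r b a κ ν)
    (fun p : Fin N × Fin r => xiHat ((S p.1).xi (ρ p.1) (x₀ p.1)) (φ₀ p.1) p.2)
  set ξ : ∀ i, ℝ → Fin (ρ i) → ℝ := fun i t k => z t (i, ⟨k, k.2.trans_le (hr i)⟩) with hξ
  set φ : ∀ i, ℝ → Fin (r - ρ i) → ℝ :=
    fun i t k => z t (i, ⟨ρ i + k, by have := k.2; have := hr i; omega⟩) with hφ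
  have hhat : ∀ i t, xiHat (ξ i t) (φ i t) = fun l => z t (i, l) := by
    intro i t
    ext l
    by_cases hl : (l : ℕ) < ρ i
    · rw [xiHat_of_lt hl]
    · rw [xiHat_of_ge hl]
      simp only [hφ]
      congr 3
      exact Nat.add_sub_of_le (not_lt.1 hl)
  set v : Fin N → ℝ → ℝ := fun i t => coopInput a κ ν (fun j l => z t (j, l)) i with hv
  have hrow : ∀ i t (k : Fin r), HasDerivAt (fun t => z t (i, k))
      (xiHat (chainField b (ξ i t) (φ i t) (v i t)) (matD r (ρ i) b *ᵥ ξ i t +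
        matE r (ρ i) b *ᵥ φ i t + v i t • vecB (r - ρ i)) k) t := by
    intro i t k
    refine (hasDerivAt_pi.1 (hz t) (i, k)).congr_deriv ?_
    rw [closedLoopMatrix_mulVec, ← matA_mulVec_xiHat (hρ i).1 (hr i), hhat]
    rfl
  have hξ' : ∀ i t, HasDerivAt (ξ i) (chainField b (ξ i t) (φ i t) (v i t)) t := by
    intro i t
    refine hasDerivAt_pi.2 fun k => (hrow i t _).congr_deriv ?_
    rw [xiHat_of_lt (k := ⟨k, k.2.trans_le (hr i)⟩) k.2]
  have hφ' : ∀ i t, HasDerivAt (φ i) (matD r (ρ i) b *ᵥ ξ i t +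
        matE r (ρ i) b *ᵥ φ i t + v i t • vecB (r - ρ i)) t := by
    intro i t
    refine hasDerivAt_pi.2 fun k => (hrow i t _).congr_deriv ?_
    rw [xiHat_of_ge (by simp)]
    simp
  choose η hη0 hη using fun i => exists_global_solution (hLip i) (hISS i)
    (ξ := ξ i) (continuous_iff_continuousAt.2 fun t => (hξ' i t).continuousAt) (Φ i (x₀ i)).2
  set x : ∀ i, ℝ → EuclideanSpace ℝ (Fin (n i)) := fun i t => (Φ i).symm (ξ i t, η i t) with hx
  have hξx : ∀ i t, (S i).xi (ρ i) (x i t) = ξ i t := by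
    intro i t
    rw [← (hΦ i).fst_eq, hx, Equiv.apply_symm_apply]
  have hvx : ∀ i t,
      coopInput a κ ν (fun j => xiHat ((S j).xi (ρ j) (x j t)) (φ j t)) i = v i t := by
    intro i t
    simp only [hξx, hhat, hv]
  refine ⟨x, φ, ⟨fun i t ht => ?_, fun i t ht => ?_⟩, fun i => ?_, fun i => ?_⟩
  · rw [hvx]
    exact (hΦ i).hasDerivWithinAt_symm (hρ i) (hξ' i t).hasDerivWithinAt (hη i t ht)
  · rw [hvx, hξx]
    exact (hφ' i t).hasDerivWithinAt
  · rw [hx, Equiv.symm_apply_eq, hη0]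
    refine Prod.ext ?_ rfl
    rw [(hΦ i).fst_eq]
    ext k
    simp only [hξ, hz0]
    exact xiHat_of_lt (k := ⟨k, k.2.trans_le (hr i)⟩) k.2
  · ext k
    simp only [hφ, hz0]
    rw [xiHat_of_ge (by simp)]
    congr 1
    simp

variable {x : ∀ i, ℝ → EuclideanSpace ℝ (Fin (n i))} {φ : ∀ i, ℝ → Fin (r - ρ i) → ℝ}

lemma IsClosedLoopSolution.hasDerivWithinAt_xiHat (hρ : ∀ i, (S i).HasRelativeDegree (ρ i))
    (hr : ∀ i, ρ i ≤ r) (hΦ : ∀ i, IsNormalForm (S i) (ρ i) (Φ i))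
    (h : IsClosedLoopSolution S ρ b a κ ν x φ) {t : ℝ} (ht : 0 ≤ t) (i : Fin N) :
    HasDerivWithinAt (fun t => xiHat ((S i).xi (ρ i) (x i t)) (φ i t))
      (matA r b *ᵥ xiHat ((S i).xi (ρ i) (x i t)) (φ i t) +
        coopInput a κ ν (fun j => xiHat ((S j).xi (ρ j) (x j t)) (φ j t)) i • vecB r)
      (Ici 0) t := by
  rw [matA_mulVec_xiHat (hρ i).1 (hr i)]
  refine hasDerivWithinAt_pi.2 fun k => ?_
  by_cases hk : (k : ℕ) < ρ i
  · simp only [xiHat_of_lt hk]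
    have h1 := ((hΦ i).differentiable_lie hk (x i t)).hasFDerivAt.comp_hasDerivWithinAt t
      (h.agent i t ht)
    exact h1.congr_deriv (fderiv_lie_agentField (hρ i) b _ _ _ ⟨k, hk⟩)
  · simp only [xiHat_of_ge hk]
    exact hasDerivWithinAt_pi.1 (h.controller i t ht) _

end Trajectories

end MAS

theorem theorem2 {N : ℕ} (n : Fin N → ℕ) (S : ∀ i, MAS.Agent (n i))
    -- relative degrees and their maximum
    (ρ : Fin N → ℕ) (hρ : ∀ i, (S i).HasRelativeDegree (ρ i))
    (r : ℕ) (hr : IsGreatest (Set.range ρ) r)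
    -- normal forms with input-to-state stable internal dynamics
    (Φ : ∀ i, EuclideanSpace ℝ (Fin (n i)) ≃
      (Fin (ρ i) → ℝ) × EuclideanSpace ℝ (Fin (n i - ρ i)))
    (hΦ : ∀ i, MAS.IsNormalForm (S i) (ρ i) (Φ i))
    (hLip : ∀ i, LocallyLipschitz (MAS.internalField (S i) (ρ i) (Φ i)))
    (hISS : ∀ i, MAS.IsISS (MAS.internalField (S i) (ρ i) (Φ i)))
    -- weighted digraph with a spanning tree
    (a : Matrix (Fin N) (Fin N) ℝ) (ha : ∀ i j, 0 ≤ a i j) (hG : MAS.HasSpanningTree a)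
    -- controller data
    (b : ℕ → ℝ) (hA : MAS.SingleZeroOthersStable (MAS.matA r b))
    (ν : Fin r → ℝ) (hν : Matrix.vecMul ν (MAS.matA r b) = 0) (hBν : 0 < MAS.vecB r ⬝ᵥ ν)
    (μ q₁ rhat : ℝ) (hμ : 0 < μ) (hq₁ : 0 < q₁) (hrhat : 0 < rhat) :
    -- every initial condition gives rise to a closed-loop trajectory on `[0, ∞)`
    (∀ (x₀ : ∀ i, EuclideanSpace ℝ (Fin (n i))) (φ₀ : ∀ i, Fin (r - ρ i) → ℝ),
      ∃ (x : ∀ i, ℝ → EuclideanSpace ℝ (Fin (n i))) (φ : ∀ i, ℝ → Fin (r - ρ i) → ℝ),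
        MAS.IsClosedLoopSolution S ρ b a (μ * √(q₁ * rhat)) ν x φ ∧
        (∀ i, x i 0 = x₀ i) ∧ (∀ i, φ i 0 = φ₀ i)) ∧
    -- along every closed-loop trajectory the outputs reach consensus, and the linearized states
    -- obey the linear dynamics with matrix `I ⊗ A - μ √(q₁ r̂) L ⊗ B νᵀ`
    (∀ (x : ∀ i, ℝ → EuclideanSpace ℝ (Fin (n i))) (φ : ∀ i, ℝ → Fin (r - ρ i) → ℝ),
      MAS.IsClosedLoopSolution S ρ b a (μ * √(q₁ * rhat)) ν x φ →
        MAS.OutputConsensus S x ∧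
        ∀ t, 0 ≤ t → HasDerivWithinAt
          (fun s (p : Fin N × Fin r) =>
            MAS.xiHat ((S p.1).xi (ρ p.1) (x p.1 s)) (φ p.1 s) p.2)
          (Matrix.mulVec (MAS.closedLoopMatrix r b a (μ * √(q₁ * rhat)) ν)
            (fun p : Fin N × Fin r =>
              MAS.xiHat ((S p.1).xi (ρ p.1) (x p.1 t)) (φ p.1 t) p.2))
          (Set.Ici 0) t) ∧
    -- consensus speed
    MAS.consensusSpeed (MAS.closedLoopMatrix r b a (μ * √(q₁ * rhat)) ν) =
      min (((μ * √(q₁ * rhat) * (MAS.vecB r ⬝ᵥ ν) : ℝ) : EReal) *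
          MAS.reLamMin (MAS.laplacian a))
        (MAS.reLamMin (-MAS.matA r b)) ∧
    -- the Riccati equation with `Q₁ = q₁ ν νᵀ` has exactly one positive semidefinite solution,
    -- namely `P₁ = (√q₁ / (√r̂ Bᵀν)) ν νᵀ`
    (∀ P : Matrix (Fin r) (Fin r) ℝ,
      (P.PosSemidef ∧ MAS.IsRiccatiSolution (MAS.matA r b) (MAS.vecB r)
          (q₁ • Matrix.vecMulVec ν ν) rhat P) ↔
        P = (√q₁ / (√rhat * (MAS.vecB r ⬝ᵥ ν))) • Matrix.vecMulVec ν ν) ∧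
    -- and the gain of the cooperative input is `r̂ Bᵀ P₁`
    rhat • Matrix.vecMul (MAS.vecB r)
        ((√q₁ / (√rhat * (MAS.vecB r ⬝ᵥ ν))) • Matrix.vecMulVec ν ν) =
      √(q₁ * rhat) • ν := by
  have hle : ∀ i, ρ i ≤ r := fun i => hr.2 ⟨i, rfl⟩
  have hN : Nonempty (Fin N) := ⟨hG.choose⟩
  have hκ : 0 < μ * √(q₁ * rhat) := mul_pos hμ (Real.sqrt_pos.2 (mul_pos hq₁ hrhat))
  have hsq : 0 < √rhat := Real.sqrt_pos.2 hrhat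
  have hsq₁ : 0 < √q₁ := Real.sqrt_pos.2 hq₁
  have hc0 : 0 < √q₁ / (√rhat * (MAS.vecB r ⬝ᵥ ν)) := div_pos hsq₁ (mul_pos hsq hBν)
  -- The coefficient of P₁ is the positive root c of r̂ (c Bᵀν)² = q₁.
  have hc : rhat * (√q₁ / (√rhat * (MAS.vecB r ⬝ᵥ ν)) * (MAS.vecB r ⬝ᵥ ν)) ^ 2 = q₁ := by
    rw [← div_div, div_mul_cancel₀ _ hBν.ne', div_pow, Real.sq_sqrt hq₁.le, Real.sq_sqrt hrhat.le,
      mul_div_cancel₀ _ hrhat.ne']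
  refine ⟨MAS.exists_closedLoopSolution hρ hle hΦ hLip hISS, fun x φ h => ⟨fun i j => ?_,
    fun t ht => ?_⟩, MAS.consensusSpeed_closedLoopMatrix ha hA hν hBν hκ, fun P => ⟨fun h => ?_, ?_⟩,
    ?_⟩
  · have h0 : ∀ i, 0 < r := fun i => (hρ i).1.trans_le (hle i)
    have h1 := MAS.tendsto_sub_of_linear_closedLoop ha hG hA hν hBν hκ
      (z := fun t i => MAS.xiHat ((S i).xi (ρ i) (x i t)) (φ i t))
      (fun t ht i => h.hasDerivWithinAt_xiHat hρ hle hΦ ht i) i j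
    -- Coordinate 0 of ξ̂_i is the output y_i, since every relative degree is at least 1.
    have h2 := (tendsto_pi_nhds.1 h1 ⟨0, h0 i⟩).abs
    rw [Pi.zero_apply, abs_zero] at h2
    refine h2.congr fun t => ?_
    rw [Pi.sub_apply, MAS.xiHat_of_lt (k := ⟨0, h0 i⟩) (hρ i).1,
      MAS.xiHat_of_lt (k := ⟨0, h0 i⟩) (hρ j).1]
    rfl
  · refine hasDerivWithinAt_pi.2 fun p => ?_
    obtain ⟨i, k⟩ := p
    rw [MAS.closedLoopMatrix_mulVec]
    exact hasDerivWithinAt_pi.1 (h.hasDerivWithinAt_xiHat hρ hle hΦ ht i) k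
  · exact MAS.riccati_unique hA hν hBν hq₁ hrhat hc0 hc h.1 h.2
  · rintro rfl
    refine ⟨?_, MAS.isRiccatiSolution_rankOne hν hc⟩
    simpa using (Matrix.posSemidef_vecMulVec_self_star ν).smul hc0.le
  · rw [Matrix.vecMul_smul, Matrix.vecMul_vecMulVec, smul_smul, smul_smul,
      Real.sqrt_mul hq₁.le]
    congr 1
    rw [mul_assoc, ← div_div, div_mul_cancel₀ _ hBν.ne', ← mul_div_assoc, div_eq_iff hsq.ne',
      mul_assoc, Real.mul_self_sqrt hrhat.le, mul_comm]
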